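/- **Theorem.** All quantum systems are finite-dimensional and all alphabets finite. Let $n\ge 0$, and for each round $i\in\{1,\dots,n\}$ let $\{M^i_{sp}\}_{s\in\mathcal S,p\in\mathcal P}$ be a POVM on a Hilbert space $Q_i$, with announcement POVM $M^i_p:=\sum_s M^i_{sp}$, let $t_i:\mathcal S\times\mathcal P\to\mathcal X$, and let $$\widetilde{\mathcal M}_i(\rho)=\sum_{s,p}\operatorname{Tr}[\rho M^i_{sp}]\,|s,p\rangle\langle s,p|_{S_iP_i}\otimes|t_i(s,p)\rangle\langle t_i(s,p)|_{X_i}.$$ Put $R_i=Q_{i+1}\otimes\cdots\otimes Q_n$ and $\mathcal M_i=\widetilde{\mathcal M}_i\otimes\mathrm{id}_{R_i}:R_{i-1}\to S_iP_iX_iR_i$. Consider, for each $i$, the conditions (A) (weakly dependent announcements) there is a decomposition $Q_i=\bigoplus_\lambda V_i^\lambda$ into finitely many orthogonal subspaces such that every $M^i_{sp}$ maps each $V_i^\lambda$ into itself and, for every $p$, there are constants $m^\lambda_{p}\in[0,1]$ with $M^i_p=\bigoplus_\lambda m^\lambda_{p}\,1_{V_i^\lambda}$; (B) $[M^i_{sp},M^i_{p'}]=0$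 for all $s\in\mathcal S$, $p,p'\in\mathcal P$. 1. For every $i$, (A) and (B) are equivalent. 2. Suppose that for every $i$ (A) or (B) holds. Then decompositions as in (A) exist for all $i$. For any choice of such decompositions and any initial state $\rho_{Q_1^nE}$, the sequential output $(\mathcal M_n\circ\cdots\circ\mathcal M_1\otimes\mathrm{id}_E)(\rho_{Q_1^nE})$ equals $\rho_{S_1^nP_1^nX_1^nE}:=(\bigotimes_i\widetilde{\mathcal M}_i\otimes\mathrm{id}_E)(\rho_{Q_1^nE})$, and there is a state $\nu_{Q_1^nE'}$, $E'=E\Lambda_1^n$, which without loss of generality replaces $\rho$ as Eve's attack, such that: * (block-diagonal form) $\nu_{Q_1^nE\Lambda_1^n}=\sum_{\lambda=(\lambda_1,\dots,\lambda_n)}\rho_{Q_1^nE}(\lambda)\otimes|\lambda\rangle\langle\lambda|_{\Lambda_1^n}$ with $\rho_{Q_1^nE}(\lambda)\ge 0$ and $\operatorname{Tr}_E\rho_{Q_1^nE}(\lambda)$ an operator on $\bigotimes_iV_i^{\lambda_i}$; * $\operatorname{Tr}_{\Lambda_1^n}[\nu_{S_1^nP_1^nX_1^nE\Lambda_1^n}]=\rho_{S_1^nP_1^nX_1^nE}$,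 where $\nu_{S_1^nP_1^nX_1^nE'}=(\bigotimes_i\widetilde{\mathcal M}_i\otimes\mathrm{id}_{E'})(\nu_{Q_1^nE'})$ is also the sequential output for $\nu$; * (Markov chain conditions) $I(S_1^{i-1}:P_i\,|\,P_1^{i-1}E')_\nu=0$ for all $i\in\{1,\dots,n\}$; * (the EAT applies) the hypotheses of the entropy accumulation theorem hold for $\mathcal M_1,\dots,\mathcal M_n$ and the initial state $\nu$: each $\mathcal M_i$ is a completely positive trace-preserving map with classical outputs $S_i,P_i,X_i$ in which $X_i$ is a deterministic function of $(S_i,P_i)$, $R_n$ is trivial, and the output state satisfies the Markov chain conditions; * for every event $\Omega\subseteq\mathcal X^n$ one has $\nu[\Omega]=\rho[\Omega]$, and if $\rho[\Omega]>0$ then for all $\alpha\in(1,2)$ and $\varepsilon\in[0,1)$ $$H^\uparrow_\alpha(S_1^n|P_1^nE')_{\nu_{|\Omega}}\le H^\uparrow_\alpha(S_1^n|P_1^nE)_{\rho_{|\Omega}},\qquad H^\varepsilon_{\min}(S_1^n|P_1^nE')_{\nu_{|\Omega}}\le H^\varepsilon_{\min}(S_1^n|P_1^nE)_{\rho_{|\Omega}},$$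 so every lower bound that the entropy accumulation theorem gives for $\nu$ holds for $\rho$ with the same passing probability. Here $\rho_{|\Omega}$ is the renormalized state conditioned on $X_1^n\in\Omega$, $H^\uparrow_\alpha(A|B)_\rho=\sup_{\sigma_B}-D_\alpha(\rho_{AB}\|1_A\otimes\sigma_B)$ is the sandwiched Rényi conditional entropy, and $H^\varepsilon_{\min}$ is the smooth min-entropy (smoothing over subnormalized states in purified distance). -/

import Mathlib

open scoped Matrix ComplexOrder Kronecker

noncomputable section

namespace QKD

/-! ### Finite-dimensional quantum systems

A quantum system with orthonormal basis indexed by a finite type `a` is `ℂ^a`; its operators are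
matrices over `a`, and composite systems are indexed by products. -/

section Basic

variable {a b c e : Type*} [Fintype a] [Fintype b] [Fintype c] [Fintype e]

/-- Density operators. -/
def IsState (ρ : Matrix a a ℂ) : Prop :=
  ρ.PosSemidef ∧ ρ.trace = 1

/-- Subnormalized density operators. -/
def IsSubState (ρ : Matrix a a ℂ) : Prop :=
  ρ.PosSemidef ∧ ρ.trace.re ≤ 1

/-- Partial trace over the first tensor factor. -/
def traceLeft (ρ : Matrix (a × b) (a × b) ℂ) : Matrix b b ℂ :=
  Matrix.of fun j j' => ∑ i, ρ (i, j) (i, j')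

/-- Partial trace over the second tensor factor. -/
def traceRight (ρ : Matrix (a × b) (a × b) ℂ) : Matrix a a ℂ :=
  Matrix.of fun i i' => ∑ j, ρ (i, j) (i', j)

/-- The map `Φ ⊗ id_E`. -/
def tensorId (Φ : Matrix a a ℂ →ₗ[ℂ] Matrix b b ℂ) (ω : Matrix (a × e) (a × e) ℂ) :
    Matrix (b × e) (b × e) ℂ :=
  Matrix.of fun x y => Φ (Matrix.of fun i j => ω (i, x.2) (j, y.2)) x.1 y.1

/-- Complete positivity: `Φ ⊗ id` on every finite-dimensional ancilla preserves positivity. -/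
def IsCompletelyPositive (Φ : Matrix a a ℂ →ₗ[ℂ] Matrix b b ℂ) : Prop :=
  ∀ (k : ℕ) (ω : Matrix (a × Fin k) (a × Fin k) ℂ), ω.PosSemidef → (tensorId Φ ω).PosSemidef

end Basic

/-! ### Entropies -/

section Entropy

variable {a b c : Type*} [Fintype a] [DecidableEq a] [Fintype b] [DecidableEq b]
  [Fintype c] [DecidableEq c]

/-- Von Neumann entropy (in bits), `H(ρ) = -Tr[ρ log₂ ρ]`. -/
def vonNeumannEntropy (ρ : Matrix a a ℂ) : ℝ :=
  (cfc Real.negMulLog ρ).trace.re / Real.log 2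

/-- Conditional mutual information `I(A:C|B) = H(AB) + H(BC) - H(B) - H(ABC)`. -/
def condMutualInfo (ρ : Matrix (a × b × c) (a × b × c) ℂ) : ℝ :=
  vonNeumannEntropy (traceRight (ρ.submatrix (Equiv.prodAssoc a b c) (Equiv.prodAssoc a b c)))
    + vonNeumannEntropy (traceLeft ρ)
    - vonNeumannEntropy (traceRight (traceLeft ρ))
    - vonNeumannEntropy ρ

/-- Real power of a positive semidefinite matrix; for a nonzero exponent the kernel is sent to `0`,
so negative powers are taken on the support. -/
def matrixPow (ρ : Matrix a a ℂ) (r : ℝ) : Matrix a a ℂ :=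
  cfc (fun x : ℝ => x ^ r) ρ

open Classical in
/-- Minimal (sandwiched) Rényi divergence for `α > 1`:
`D_α(ρ‖σ) = 1/(α-1) · log₂ (Tr[(σ^((1-α)/2α) ρ σ^((1-α)/2α))^α] / Tr ρ)` if
`supp ρ ⊆ supp σ`, and `+∞` otherwise. -/
def sandwichedDivergence (α : ℝ) (ρ σ : Matrix a a ℂ) : EReal :=
  if ∀ v : a → ℂ, σ *ᵥ v = 0 → ρ *ᵥ v = 0 then
    ((1 / (α - 1) * Real.logb 2
      ((matrixPow (matrixPow σ ((1 - α) / (2 * α)) * ρ * matrixPow σ ((1 - α) / (2 * α))) α).trace.re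
        / ρ.trace.re) : ℝ) : EReal)
  else ⊤

/-- The sandwiched Rényi conditional entropy
`H_α^↑(A|B)_ρ = sup_{σ_B} -D_α(ρ_AB ‖ 1_A ⊗ σ_B)`, the supremum being over states `σ_B`. -/
def renyiEntropyUp (α : ℝ) (ρ : Matrix (a × b) (a × b) ℂ) : EReal :=
  ⨆ σ : {σ : Matrix b b ℂ // IsState σ},
    -sandwichedDivergence α ρ ((1 : Matrix a a ℂ) ⊗ₖ σ.1)

/-- Trace norm `‖A‖₁ = Tr √(A† A)`. -/
def traceNorm (A : Matrix a a ℂ) : ℝ :=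
  (cfc Real.sqrt (Aᴴ * A)).trace.re

/-- Generalized fidelity `‖√ρ √σ‖₁ + √((1 - Tr ρ)(1 - Tr σ))` of subnormalized states. -/
def generalizedFidelity (ρ σ : Matrix a a ℂ) : ℝ :=
  traceNorm (cfc Real.sqrt ρ * cfc Real.sqrt σ)
    + Real.sqrt ((1 - ρ.trace.re) * (1 - σ.trace.re))

/-- Purified distance of subnormalized states. -/
def purifiedDistance (ρ σ : Matrix a a ℂ) : ℝ :=
  Real.sqrt (1 - generalizedFidelity ρ σ ^ 2)

/-- Smooth min-entropy: `H_min^ε(A|B)_ρ` is the largest `l` for which some subnormalized `ρ'`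
within purified distance `ε` of `ρ` and some `Y_B ≥ 0` satisfy `ρ' ≤ 1_A ⊗ Y_B` and
`-log₂ (Tr Y_B) ≥ l`. -/
def smoothMinEntropy (ε : ℝ) (ρ : Matrix (a × b) (a × b) ℂ) : EReal :=
  sSup {l : EReal | ∃ r : ℝ, l = (r : EReal) ∧
    ∃ ρ' : Matrix (a × b) (a × b) ℂ, IsSubState ρ' ∧ purifiedDistance ρ' ρ ≤ ε ∧
    ∃ Y : Matrix b b ℂ, Y.PosSemidef ∧ (((1 : Matrix a a ℂ) ⊗ₖ Y) - ρ').PosSemidef ∧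
      Y.trace.re ≤ (2 : ℝ) ^ (-r)}

end Entropy

/-! ### States with classical outcomes

A state `∑_y |y⟩⟨y| ⊗ ω_y` that is classical on a register with values in `Y` is the family
`ω : Y → Matrix e e ℂ`. One round of the protocol has outcomes `(s, p, x) : S × P × X`, and `n`
rounds have outcomes `Fin n → S × P × X`. -/

section Classical

variable {Y Z S P X e : Type*} {n : ℕ}

/-- Marginal on a register `Z` that is a function `g` of the classical register. -/
def classicalMarginal [Fintype Y] [DecidableEq Z] (g : Y → Z) (ω : Y → Matrix e e ℂ) :
    Z → Matrix e e ℂ :=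
  fun z => ∑ y with g y = z, ω y

/-- The test results `x_1^n`. -/
def testResults (y : Fin n → S × P × X) : Fin n → X := fun i => (y i).2.2

/-- The probability `ω[Ω]` of an event `Ω ⊆ X^n` on the test registers. -/
def eventProb [Fintype S] [Fintype P] [Fintype X] [DecidableEq X] [Fintype e]
    (ω : (Fin n → S × P × X) → Matrix e e ℂ) (Ω : Finset (Fin n → X)) : ℝ :=
  ∑ y with testResults y ∈ Ω, (ω y).trace.re

/-- The (renormalized) state conditioned on the event `Ω`. -/
def conditioned [Fintype S] [Fintype P] [Fintype X] [DecidableEq X] [Fintype e]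
    (ω : (Fin n → S × P × X) → Matrix e e ℂ) (Ω : Finset (Fin n → X)) :
    (Fin n → S × P × X) → Matrix e e ℂ :=
  fun y => if testResults y ∈ Ω then ((eventProb ω Ω)⁻¹ : ℂ) • ω y else 0

variable [Fintype S] [DecidableEq S] [Fintype P] [DecidableEq P] [Fintype X] [DecidableEq X]

/-- The marginal on `S_1^n` and `P_1^n E`, as an operator on that bipartite system. -/
def secretPublic (ω : (Fin n → S × P × X) → Matrix e e ℂ) :
    Matrix ((Fin n → S) × (Fin n → P) × e) ((Fin n → S) × (Fin n → P) × e) ℂ :=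
  Matrix.of fun u v =>
    if u.1 = v.1 ∧ u.2.1 = v.2.1 then
      classicalMarginal (fun y : Fin n → S × P × X => (fun j => (y j).1, fun j => (y j).2.1))
        ω (u.1, u.2.1) u.2.2 v.2.2
    else 0

/-- The marginal on `S_1^{i-1}`, `P_1^{i-1} E` and `P_i`, as an operator on that tripartite
system (rounds are counted from `0`, so `Fin i` indexes the rounds preceding round `i`). -/
def pastAndAnnouncement (ω : (Fin n → S × P × X) → Matrix e e ℂ) (i : Fin n) :
    Matrix ((Fin i → S) × ((Fin i → P) × e) × P) ((Fin i → S) × ((Fin i → P) × e) × P) ℂ :=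
  Matrix.of fun u v =>
    if u.1 = v.1 ∧ u.2.1.1 = v.2.1.1 ∧ u.2.2 = v.2.2 then
      classicalMarginal (fun y : Fin n → S × P × X =>
          (fun j : Fin i => (y (j.castLE i.isLt.le)).1,
            fun j : Fin i => (y (j.castLE i.isLt.le)).2.1, (y i).2.1))
        ω (u.1, u.2.1.1, u.2.2) u.2.1.2 v.2.1.2
    else 0

/-- The Markov chain conditions `S_1^{i-1} ↔ P_1^{i-1} E ↔ P_i` for all rounds `i`, that is
`I(S_1^{i-1} : P_i | P_1^{i-1} E) = 0`. -/
def MarkovConditions [Fintype e] [DecidableEq e] (ω : (Fin n → S × P × X) → Matrix e e ℂ) : Prop :=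
  ∀ i : Fin n, condMutualInfo (pastAndAnnouncement ω i) = 0

end Classical

/-! ### EAT channels and their sequential composition -/

section Sequential

variable {S P X : Type*} [Fintype S] [Fintype P] [Fintype X]

/-- A map `R → S P X R'` with classical outputs `S P X`, written as
`ω ↦ ∑_{s,p,x} |s,p,x⟩⟨s,p,x| ⊗ Φ s p x ω`. It is an EAT channel when it is completely positive and
trace preserving and `x` is a deterministic function `t (s, p)`. -/
def IsEATChannel {a b : Type*} [Fintype a] [Fintype b]
    (Φ : S → P → X → Matrix a a ℂ →ₗ[ℂ] Matrix b b ℂ) : Prop :=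
  (∀ s p x, IsCompletelyPositive (Φ s p x)) ∧
  (∀ ω, ∑ s, ∑ p, ∑ x, (Φ s p x ω).trace = ω.trace) ∧
  ∃ t : S → P → X, ∀ s p x, x ≠ t s p → Φ s p x = 0

variable {n : ℕ} {r : Fin (n + 1) → Type*} {e : Type*} [∀ k, Fintype (r k)] [Fintype e]

/-- The state of `(S P X)_1^k R_k E` after applying the first `k` channels (each tensored with the
identity on `E` and on the earlier outputs) to the initial state on `R_0 E`. -/
def eatState
    (Φ : ∀ i : Fin n, S → P → X → Matrix (r i.castSucc) (r i.castSucc) ℂ →ₗ[ℂ]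
      Matrix (r i.succ) (r i.succ) ℂ)
    (ρ : Matrix (r 0 × e) (r 0 × e) ℂ) :
    ∀ k : Fin (n + 1), (Fin k → S × P × X) → Matrix (r k × e) (r k × e) ℂ :=
  Fin.induction (fun _ => ρ) fun i σ (y : Fin (i + 1) → S × P × X) =>
    tensorId (Φ i (y (Fin.last i)).1 (y (Fin.last i)).2.1 (y (Fin.last i)).2.2)
      (σ fun j => y j.castSucc)

/-- The output state on `(S P X)_1^n E` of the process `(M_n ∘ ⋯ ∘ M_1) ⊗ id_E` (the final register
`R_n` is traced out; it is trivial in the EAT). -/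
def eatOutput
    (Φ : ∀ i : Fin n, S → P → X → Matrix (r i.castSucc) (r i.castSucc) ℂ →ₗ[ℂ]
      Matrix (r i.succ) (r i.succ) ℂ)
    (ρ : Matrix (r 0 × e) (r 0 × e) ℂ) : (Fin n → S × P × X) → Matrix e e ℂ :=
  fun y => traceLeft (eatState Φ ρ (Fin.last n) y)

/-- The hypotheses that the entropy accumulation theorem places on the channels `M_1, …, M_n` and on
the initial state on `R_0 E`: the `M_i` are EAT channels with classical outputs, the final register
`R_n` is trivial, and the output state satisfies the Markov chain conditions. -/
structure EATHypotheses [DecidableEq S] [DecidableEq P] [DecidableEq X] [DecidableEq e]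
    (Φ : ∀ i : Fin n, S → P → X → Matrix (r i.castSucc) (r i.castSucc) ℂ →ₗ[ℂ]
      Matrix (r i.succ) (r i.succ) ℂ)
    (ρ : Matrix (r 0 × e) (r 0 × e) ℂ) : Prop where
  channel : ∀ i, IsEATChannel (Φ i)
  final : Nonempty (Unique (r (Fin.last n)))
  initial : IsState ρ
  markov : MarkovConditions (eatOutput Φ ρ)

end Sequential

/-! ### Rounds acting in tensor product -/

section Tensor

variable {S P X : Type*} {n : ℕ} {d : Fin n → Type*} {e : Type*}

/-- `M_{sp}` is a POVM. -/
def IsPOVM {a : Type*} [Fintype a] [DecidableEq a] [Fintype S] [Fintype P]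
    (M : S → P → Matrix a a ℂ) : Prop :=
  (∀ s p, (M s p).PosSemidef) ∧ ∑ s, ∑ p, M s p = 1

/-- The announcement POVM `M_p = ∑_s M_{sp}`. -/
def announcement {a : Type*} [Fintype S] (M : S → P → Matrix a a ℂ) (p : P) : Matrix a a ℂ :=
  ∑ s, M s p

/-- Basis index of `R_k`, the tensor product of the systems `Q_j` that remain after `k` rounds. -/
abbrev Remaining (d : Fin n → Type*) (k : Fin (n + 1)) : Type _ :=
  (j : {j : Fin n // (k : ℕ) ≤ j}) → d j

/-- The basis vector of `Q_i ⊗ R_i = R_{i-1}` given by a basis vector of each factor. -/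
def Remaining.cons (i : Fin n) (a : d i) (b : Remaining d i.succ) : Remaining d i.castSucc :=
  fun j => if h : i = j.1 then h ▸ a else
    b ⟨j.1, Nat.succ_le_of_lt (lt_of_le_of_ne j.2 fun h' => h (Fin.ext h'))⟩

/-- The EAT channel of round `i`: the map
`ρ ↦ ∑_{s,p} Tr[ρ M_{sp}] |s,p⟩⟨s,p| ⊗ |t(s,p)⟩⟨t(s,p)|` on `Q_i`, tensored with the identity
on the remaining systems `R_i`. -/
def roundChannel [∀ i, Fintype (d i)] [DecidableEq X] (M : ∀ i, S → P → Matrix (d i) (d i) ℂ)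
    (t : Fin n → S → P → X) (i : Fin n) (s : S) (p : P) (x : X) :
    Matrix (Remaining d i.castSucc) (Remaining d i.castSucc) ℂ →ₗ[ℂ]
      Matrix (Remaining d i.succ) (Remaining d i.succ) ℂ where
  toFun ω := Matrix.of fun b b' =>
    if x = t i s p then
      ∑ a, ∑ a', M i s p a' a * ω (Remaining.cons i a b) (Remaining.cons i a' b')
    else 0
  map_add' ω ω' := by
    ext b b'
    by_cases h : x = t i s p <;> simp [h, mul_add, Finset.sum_add_distrib]
  map_smul' z ω := by
    ext b b'
    by_cases h : x = t i s p <;> simp [h, Finset.mul_sum, mul_left_comm]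

/-- A state on `Q_1^n E` regarded as a state on `R_0 E`. -/
def toInitial (ρ : Matrix ((∀ i, d i) × e) ((∀ i, d i) × e) ℂ) :
    Matrix (Remaining d 0 × e) (Remaining d 0 × e) ℂ :=
  ρ.submatrix (fun u => (fun j => u.1 ⟨j, Nat.zero_le _⟩, u.2))
    (fun u => (fun j => u.1 ⟨j, Nat.zero_le _⟩, u.2))

/-- The output state `(⨂_i M_i ⊗ id_E)(ρ_{Q_1^n E})` on `(S P X)_1^n E`. -/
def outputState [∀ i, Fintype (d i)] [DecidableEq X] (M : ∀ i, S → P → Matrix (d i) (d i) ℂ)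
    (t : Fin n → S → P → X) (ρ : Matrix ((∀ i, d i) × e) ((∀ i, d i) × e) ℂ) :
    (Fin n → S × P × X) → Matrix e e ℂ :=
  fun y => Matrix.of fun u v =>
    if ∀ i, (y i).2.2 = t i (y i).1 (y i).2.1 then
      ∑ a : ∀ i, d i, ∑ a' : ∀ i, d i,
        (∏ i, M i (y i).1 (y i).2.1 (a' i) (a i)) * ρ (a, u) (a', v)
    else 0

end Tensor

/-! ### Block structure -/

section Blocks

variable {S P : Type*} [Fintype S]

/-- A decomposition `Q = ⨁_λ V^λ` into finitely many orthogonal subspaces. -/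
structure BlockDecomposition (a : Type*) [Fintype a] where
  num : ℕ
  space : Fin num → Submodule ℂ (EuclideanSpace ℂ a)
  orthogonal : ∀ l l', l ≠ l' → space l ⟂ space l'
  complete : ⨆ l, space l = ⊤

/-- Weak dependence of the announcement along the decomposition `V`: every `M_{sp}` is block
diagonal (maps each `V^λ` to itself) and every `M_p` acts on each `V^λ` as a constant
`m_p^λ ∈ [0,1]`. -/
def WeaklyDependentAlong {a : Type*} [Fintype a] [DecidableEq a] (M : S → P → Matrix a a ℂ)
    (V : BlockDecomposition a) : Prop :=
  (∀ s p l, ∀ v ∈ V.space l, Matrix.toEuclideanLin (M s p) v ∈ V.space l) ∧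
  ∀ p, ∃ m : Fin V.num → ℝ, (∀ l, 0 ≤ m l ∧ m l ≤ 1) ∧
    ∀ l, ∀ v ∈ V.space l, Matrix.toEuclideanLin (announcement M p) v = (m l : ℂ) • v

/-- Condition (A): the announcement is weakly dependent along some decomposition. -/
def WeaklyDependent {a : Type*} [Fintype a] [DecidableEq a] (M : S → P → Matrix a a ℂ) : Prop :=
  ∃ V : BlockDecomposition a, WeaklyDependentAlong M V

/-- Condition (B): `[M_{sp}, M_{p'}] = 0` for all `s, p, p'`. -/
def AnnouncementsCommute {a : Type*} [Fintype a] (M : S → P → Matrix a a ℂ) : Prop :=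
  ∀ s p p', M s p * announcement M p' = announcement M p' * M s p

variable {n : ℕ} {d : Fin n → Type*} [∀ i, Fintype (d i)] {e : Type*}

/-- The subspace `⨂_i W_i` of `⨂_i Q_i`, spanned by the product vectors. -/
def tensorSubspace (W : ∀ i, Submodule ℂ (EuclideanSpace ℂ (d i))) :
    Submodule ℂ (EuclideanSpace ℂ (∀ i, d i)) :=
  Submodule.span ℂ {w | ∃ v : ∀ i, EuclideanSpace ℂ (d i),
    (∀ i, v i ∈ W i) ∧ ∀ a, w a = ∏ i, v i (a i)}

/-- The register `Λ_1^n` of block labels. -/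
abbrev Labels (V : ∀ i, BlockDecomposition (d i)) : Type := ∀ i, Fin (V i).num

/-- `ν` on `Q_1^n E'`, `E' = E Λ_1^n`, is a block-diagonal attack:
`ν = ∑_λ ρ(λ) ⊗ |λ⟩⟨λ|` where the `ρ(λ) ≥ 0` on `Q_1^n E` are such that
`Tr_E ρ(λ)` is an operator on `V^λ = ⨂_i V^{λ_i}`. -/
def IsBlockDiagonalAttack [∀ i, DecidableEq (d i)] [Fintype e] (V : ∀ i, BlockDecomposition (d i))
    (ν : Matrix ((∀ i, d i) × e × Labels V) ((∀ i, d i) × e × Labels V) ℂ) : Prop :=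
  ∃ ρ : Labels V → Matrix ((∀ i, d i) × e) ((∀ i, d i) × e) ℂ,
    (∀ l, (ρ l).PosSemidef) ∧
    (∀ u v, ν u v = if u.2.2 = v.2.2 then ρ u.2.2 (u.1, u.2.1) (v.1, v.2.1) else 0) ∧
    ∀ l w, Matrix.toEuclideanLin (traceRight (ρ l)) w ∈ tensorSubspace fun i => (V i).space (l i)

end Blocks

end QKD

end

/-! The equivalence of (A) and (B) is simultaneous diagonalization. Under (B) the Hermitian
operators `M_p` commute, their joint eigenspaces decompose the space orthogonally, and every `M_sp`
preserves these eigenspaces because it commutes with all `M_p`. Conversely, an operator that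
preserves the blocks commutes with one that is scalar on each block.

For the second claim, Eve's modified attack measures the block labels with the projections `P_l = ⨂
P_{l_i}` and keeps the result: `blockAttack` is the pinching of `ρ` together with a classical copy
of `l`. The effects of the protocol commute with the projections, so `∑_l P_l N P_l = N`. Discarding
the labels therefore recovers every output of `ρ`, including Eve's conditional states
(`traceRight_contract_blockAttack`). Given `l`, the operator `M_p` of round `i` is a scalar on the
block. The announcement thus has a fixed law depending only on `l_i`, independent of Eve and of the
past outcomes, which makes the conditional mutual information vanish
(`condMutualInfo_eq_zero_of_conditionally_independent`). Sequential and parallel application agree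
because distinct rounds act on distinct tensor factors; `contract_eatState` is the corresponding
invariant.

The entropy inequalities say that discarding the labels, a channel on the conditioning system alone,
cannot decrease a conditional entropy. They rest on two monotonicity statements for trace-preserving
maps in Kraus form. For the sandwiched Rényi divergence with `α > 1`, the three lines theorem
interpolates between two Cauchy–Schwarz bounds (`trace_sandwiched_pow_le`). For the fidelity, the
trace norm is a maximum over contractions, and Kraus operators are stacked into one dilation
(`traceNorm_sqrt_mul_sqrt_le_krausMap`). -/

noncomputable section

set_option linter.unusedSectionVars false

namespace QKD

/-! ### Functions of Hermitian matrices -/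

section SpectralFunction

variable {a : Type*} [Fintype a] [DecidableEq a] {A : Matrix a a ℂ}

/-- The matrix obtained from a Hermitian matrix by applying a complex-valued function to its
eigenvalues. -/
def spectralFn (hA : A.IsHermitian) (g : ℝ → ℂ) : Matrix a a ℂ :=
  (hA.eigenvectorUnitary : Matrix a a ℂ) * Matrix.diagonal (fun i => g (hA.eigenvalues i)) *
    (hA.eigenvectorUnitary : Matrix a a ℂ)ᴴ

theorem eigenvectorUnitary_conjTranspose_mul (hA : A.IsHermitian) :
    (hA.eigenvectorUnitary : Matrix a a ℂ)ᴴ * (hA.eigenvectorUnitary : Matrix a a ℂ) = 1 := by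
  rw [← Matrix.star_eq_conjTranspose]
  exact Unitary.coe_star_mul_self _

theorem eigenvectorUnitary_mul_conjTranspose (hA : A.IsHermitian) :
    (hA.eigenvectorUnitary : Matrix a a ℂ) * (hA.eigenvectorUnitary : Matrix a a ℂ)ᴴ = 1 := by
  rw [← Matrix.star_eq_conjTranspose]
  exact Unitary.coe_mul_star_self _

theorem cfc_eq_spectralFn (hA : A.IsHermitian) (f : ℝ → ℝ) :
    cfc f A = spectralFn hA (fun x => (f x : ℂ)) := by
  rw [hA.cfc_eq, Matrix.IsHermitian.cfc, Unitary.conjStarAlgAut_apply, spectralFn]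
  rfl

theorem spectralFn_mul (hA : A.IsHermitian) (g h : ℝ → ℂ) :
    spectralFn hA g * spectralFn hA h = spectralFn hA (fun x => g x * h x) := by
  simp only [spectralFn, Matrix.mul_assoc]
  rw [← Matrix.mul_assoc (_ᴴ) _ (_ * _), eigenvectorUnitary_conjTranspose_mul, Matrix.one_mul,
    ← Matrix.mul_assoc (Matrix.diagonal _) (Matrix.diagonal _), Matrix.diagonal_mul_diagonal]

theorem spectralFn_conjTranspose (hA : A.IsHermitian) (g : ℝ → ℂ) :
    (spectralFn hA g)ᴴ = spectralFn hA (fun x => star (g x)) := by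
  simp only [spectralFn, Matrix.conjTranspose_mul, Matrix.conjTranspose_conjTranspose,
    Matrix.diagonal_conjTranspose, Matrix.mul_assoc]
  rfl

theorem spectralFn_id (hA : A.IsHermitian) : spectralFn hA (fun x => (x : ℂ)) = A := by
  rw [← cfc_eq_spectralFn hA (fun x => x)]
  exact cfc_id' ℝ A

theorem spectralFn_one (hA : A.IsHermitian) : spectralFn hA (fun _ => 1) = 1 := by
  simp [spectralFn, eigenvectorUnitary_mul_conjTranspose]

theorem spectralFn_congr (hA : A.IsHermitian) {g h : ℝ → ℂ}
    (hgh : ∀ i, g (hA.eigenvalues i) = h (hA.eigenvalues i)) :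
    spectralFn hA g = spectralFn hA h := by
  simp only [spectralFn, hgh]

theorem spectralFn_congr_nonneg (hA : A.PosSemidef) {g h : ℝ → ℂ}
    (hgh : ∀ x, 0 ≤ x → g x = h x) : spectralFn hA.1 g = spectralFn hA.1 h :=
  spectralFn_congr _ fun i => hgh _ (hA.eigenvalues_nonneg i)

theorem trace_spectralFn (hA : A.IsHermitian) (g : ℝ → ℂ) :
    (spectralFn hA g).trace = ∑ i, g (hA.eigenvalues i) := by
  rw [spectralFn, Matrix.trace_mul_comm, ← Matrix.mul_assoc, eigenvectorUnitary_conjTranspose_mul,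
    Matrix.one_mul, Matrix.trace_diagonal]

theorem trace_cfc (hA : A.IsHermitian) (f : ℝ → ℝ) :
    (cfc f A).trace = ∑ i, (f (hA.eigenvalues i) : ℂ) := by
  rw [cfc_eq_spectralFn hA, trace_spectralFn]

theorem spectralFn_apply (hA : A.IsHermitian) (g : ℝ → ℂ) (i j : a) :
    spectralFn hA g i j = ∑ k, (hA.eigenvectorUnitary : Matrix a a ℂ) i k *
      g (hA.eigenvalues k) * star ((hA.eigenvectorUnitary : Matrix a a ℂ) j k) := by
  simp [spectralFn, Matrix.mul_apply, Matrix.diagonal_apply]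

/-- A matrix annihilated on the kernel of `A` is fixed by the support projection of `A`. -/
theorem spectralFn_support_mul_of_ker {b : Type*} [Fintype b] (hA : A.IsHermitian)
    (B : Matrix b a ℂ) (hB : ∀ v : a → ℂ, A *ᵥ v = 0 → B *ᵥ v = 0) (g : ℝ → ℂ)
    (hg : ∀ x, x ≠ 0 → g x = 1) : B * spectralFn hA g = B := by
  -- Since `x * (1 - g x) = 0` for every `x`, the columns of `(1 - g)(A)` lie in the kernel of `A`,
  -- where `B` vanishes.
  have key : B * spectralFn hA (fun x => 1 - g x) = 0 := by
    have h0 : A * spectralFn hA (fun x => 1 - g x) = 0 := by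
      have h1 := congrArg (· * spectralFn hA (fun x => 1 - g x)) (spectralFn_id hA)
      simp only [spectralFn_mul] at h1
      rw [← h1]
      have : (fun x : ℝ => (x : ℂ) * (1 - g x)) = fun _ => 0 := by
        funext x
        by_cases hx : x = 0
        · simp [hx]
        · simp [hg x hx]
      rw [this]
      simp [spectralFn]
    ext i j
    have := hB (fun k => spectralFn hA (fun x => 1 - g x) k j) (by
      ext l
      exact congr_fun (congr_fun h0 l) j)
    exact congr_fun this i
  have hs : spectralFn hA (fun x => 1 - g x) + spectralFn hA g = 1 := by
    rw [← spectralFn_one hA]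
    simp only [spectralFn, ← Matrix.add_mul, ← Matrix.mul_add, Matrix.diagonal_add, sub_add_cancel]
  calc B * spectralFn hA g = B * (spectralFn hA (fun x => 1 - g x) + spectralFn hA g) := by
        rw [Matrix.mul_add, key, zero_add]
    _ = B := by rw [hs, Matrix.mul_one]

end SpectralFunction

/-! ### The Frobenius norm -/

section Frobenius

variable {a b c κ : Type*} [Fintype a] [Fintype b] [Fintype c] [Fintype κ]

/-- The squared Frobenius norm. -/
def frobSq (V : Matrix a b ℂ) : ℝ := ∑ i, ∑ j, ‖V i j‖ ^ 2

theorem frobSq_eq_trace (V : Matrix a b ℂ) : frobSq V = (Vᴴ * V).trace.re := by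
  simp only [frobSq, Matrix.trace, Matrix.diag_apply, Matrix.mul_apply,
    Matrix.conjTranspose_apply, Complex.re_sum]
  rw [Finset.sum_comm]
  refine Finset.sum_congr rfl fun j _ => Finset.sum_congr rfl fun i _ => ?_
  have : star (V i j) * V i j = ((‖V i j‖ ^ 2 : ℝ) : ℂ) := by
    rw [Complex.star_def, ← Complex.normSq_eq_conj_mul_self, Complex.normSq_eq_norm_sq]
  rw [this, Complex.ofReal_re]

theorem frobSq_conjTranspose (V : Matrix a b ℂ) : frobSq Vᴴ = frobSq V := by
  simp only [frobSq, Matrix.conjTranspose_apply, norm_star]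
  exact Finset.sum_comm

theorem frobSq_eq_trace' (V : Matrix a b ℂ) : frobSq V = (V * Vᴴ).trace.re := by
  rw [← frobSq_conjTranspose, frobSq_eq_trace, Matrix.conjTranspose_conjTranspose]

/-- The Cauchy–Schwarz inequality for the trace inner product of families of matrices. -/
theorem norm_sum_trace_conjTranspose_mul_le (V W : κ → Matrix a b ℂ) :
    ‖∑ k, ((V k)ᴴ * W k).trace‖ ≤
      Real.sqrt (∑ k, frobSq (V k)) * Real.sqrt (∑ k, frobSq (W k)) := by
  have e1 : ∀ V : κ → Matrix a b ℂ,
      ∑ k, frobSq (V k) = ∑ x : κ × a × b, ‖V x.1 x.2.1 x.2.2‖ ^ 2 := fun V => by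
    simp only [frobSq, Fintype.sum_prod_type]
  have e2 : ∑ k, ((V k)ᴴ * W k).trace =
      ∑ x : κ × a × b, star (V x.1 x.2.1 x.2.2) * W x.1 x.2.1 x.2.2 := by
    simp only [Fintype.sum_prod_type, Matrix.trace, Matrix.diag_apply, Matrix.mul_apply,
      Matrix.conjTranspose_apply]
    exact Finset.sum_congr rfl fun k _ => Finset.sum_comm
  rw [e1, e1, e2]
  refine (norm_sum_le _ _).trans ?_
  simp only [norm_mul, norm_star]
  exact Real.sum_mul_le_sqrt_mul_sqrt _ _ _

theorem norm_trace_conjTranspose_mul_le (V W : Matrix a b ℂ) :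
    ‖(Vᴴ * W).trace‖ ≤ Real.sqrt (frobSq V) * Real.sqrt (frobSq W) := by
  simpa using norm_sum_trace_conjTranspose_mul_le (κ := Unit) (fun _ => V) (fun _ => W)

theorem posSemidef_trace_re_nonneg {A : Matrix a a ℂ} (hA : A.PosSemidef) : 0 ≤ A.trace.re := by
  have := hA.trace_nonneg
  exact (Complex.le_def.1 this).1

/-- Multiplication by a contraction from the left does not increase the Frobenius norm. -/
theorem frobSq_mul_le_of_contraction [DecidableEq b] (C : Matrix a b ℂ) (G : Matrix b c ℂ)
    (hC : (1 - Cᴴ * C).PosSemidef) : frobSq (C * G) ≤ frobSq G := by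
  rw [frobSq_eq_trace, frobSq_eq_trace]
  have := posSemidef_trace_re_nonneg (hC.conjTranspose_mul_mul_same G)
  rw [Matrix.mul_sub, Matrix.sub_mul, Matrix.trace_sub, Complex.sub_re, Matrix.mul_one] at this
  rw [Matrix.conjTranspose_mul]
  simp only [Matrix.mul_assoc] at this ⊢
  linarith

variable [DecidableEq a] {A : Matrix a a ℂ}

/-- The Frobenius norm is unitarily invariant, and in the eigenbasis of `A` the right factor
multiplies each column by a number of modulus at most one. -/
theorem frobSq_mul_spectralFn_le (hA : A.IsHermitian) (g : ℝ → ℂ)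
    (hg : ∀ i, ‖g (hA.eigenvalues i)‖ ≤ 1) (V : Matrix b a ℂ) :
    frobSq (V * spectralFn hA g) ≤ frobSq V := by
  have e : ∀ W : Matrix b a ℂ, frobSq (W * (hA.eigenvectorUnitary : Matrix a a ℂ)ᴴ) = frobSq W := by
    intro W
    rw [frobSq_eq_trace', frobSq_eq_trace', Matrix.conjTranspose_mul,
      Matrix.conjTranspose_conjTranspose, Matrix.mul_assoc, ← Matrix.mul_assoc _ _ Wᴴ,
      eigenvectorUnitary_conjTranspose_mul, Matrix.one_mul]
  have e' : ∀ W : Matrix b a ℂ, frobSq (W * (hA.eigenvectorUnitary : Matrix a a ℂ)) = frobSq W := by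
    intro W
    rw [frobSq_eq_trace', frobSq_eq_trace', Matrix.conjTranspose_mul,
      Matrix.mul_assoc, ← Matrix.mul_assoc _ _ Wᴴ,
      eigenvectorUnitary_mul_conjTranspose, Matrix.one_mul]
  rw [spectralFn, ← Matrix.mul_assoc, ← Matrix.mul_assoc, e, ← e' V]
  refine Finset.sum_le_sum fun i _ => Finset.sum_le_sum fun j _ => ?_
  rw [Matrix.mul_diagonal, norm_mul, mul_pow]
  have := hg j
  have h2 : ‖g (hA.eigenvalues j)‖ ^ 2 ≤ 1 := by
    have := norm_nonneg (g (hA.eigenvalues j))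
    nlinarith
  nlinarith [sq_nonneg ‖(V * (hA.eigenvectorUnitary : Matrix a a ℂ)) i j‖]

theorem frobSq_spectralFn_mul_le (hA : A.IsHermitian) (g : ℝ → ℂ)
    (hg : ∀ i, ‖g (hA.eigenvalues i)‖ ≤ 1) (V : Matrix a b ℂ) :
    frobSq (spectralFn hA g * V) ≤ frobSq V := by
  rw [← frobSq_conjTranspose, ← frobSq_conjTranspose V, Matrix.conjTranspose_mul,
    spectralFn_conjTranspose]
  exact frobSq_mul_spectralFn_le hA _ (by simpa using hg) _

end Frobenius

/-! ### Complex powers and regularity on the strip -/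

section Strip

/-- Complex powers of nonnegative numbers, with all powers of zero equal to zero. -/
def suppPow (z : ℂ) (x : ℝ) : ℂ := if x = 0 then 0 else Complex.exp (z * Real.log x)

/-- Sending zero to zero makes the exponent law unconditional; exponent `0` then gives the indicator
of the support. -/
theorem suppPow_mul (z w : ℂ) (x : ℝ) : suppPow z x * suppPow w x = suppPow (z + w) x := by
  by_cases hx : x = 0 <;> simp [suppPow, hx, add_mul, Complex.exp_add]

theorem star_suppPow (z : ℂ) (x : ℝ) : star (suppPow z x) = suppPow (star z) x := by
  by_cases hx : x = 0
  · simp [suppPow, hx]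
  · simp only [suppPow, hx, if_false, Complex.star_def, ← Complex.exp_conj, map_mul,
      Complex.conj_ofReal]

theorem norm_suppPow_le_one {z : ℂ} (hz : z.re = 0) (x : ℝ) : ‖suppPow z x‖ ≤ 1 := by
  by_cases hx : x = 0
  · simp [suppPow, hx]
  · simp [suppPow, hx, Complex.norm_exp, hz]

/-- Exponent zero must be excluded: `Real.rpow` has `0 ^ 0 = 1`, while `suppPow 0 0 = 0`. -/
theorem suppPow_ofReal {r : ℝ} (hr : r ≠ 0) {x : ℝ} (hx : 0 ≤ x) :
    suppPow r x = ((x ^ r : ℝ) : ℂ) := by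
  by_cases h : x = 0
  · simp [suppPow, h, Real.zero_rpow hr]
  · rw [suppPow, if_neg h, Real.rpow_def_of_pos (lt_of_le_of_ne hx (Ne.symm h))]
    push_cast
    rw [mul_comm]

theorem suppPow_one {x : ℝ} (hx : 0 ≤ x) : suppPow 1 x = (x : ℂ) := by
  have := suppPow_ofReal one_ne_zero hx
  simpa using this

theorem suppPow_zero {x : ℝ} (hx : x ≠ 0) : suppPow 0 x = 1 := by
  simp [suppPow, hx]

/-- Entire functions bounded on the strip `0 ≤ re z ≤ 1`. -/
def StripRegular (f : ℂ → ℂ) : Prop :=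
  Differentiable ℂ f ∧ ∃ C, ∀ z : ℂ, 0 ≤ z.re → z.re ≤ 1 → ‖f z‖ ≤ C

theorem StripRegular.const (c : ℂ) : StripRegular fun _ => c :=
  ⟨differentiable_const c, ‖c‖, fun _ _ _ => le_rfl⟩

theorem StripRegular.mul {f g : ℂ → ℂ} (hf : StripRegular f) (hg : StripRegular g) :
    StripRegular fun z => f z * g z := by
  obtain ⟨hf, C, hC⟩ := hf
  obtain ⟨hg, D, hD⟩ := hg
  refine ⟨hf.mul hg, C * D, fun z h0 h1 => ?_⟩
  rw [norm_mul]
  exact mul_le_mul (hC z h0 h1) (hD z h0 h1) (norm_nonneg _) ((norm_nonneg _).trans (hC z h0 h1))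

theorem StripRegular.sum {ι : Type*} {s : Finset ι} {f : ι → ℂ → ℂ}
    (hf : ∀ i ∈ s, StripRegular (f i)) : StripRegular fun z => ∑ i ∈ s, f i z := by
  have h2 : ∀ i : s, ∃ C, ∀ z : ℂ, 0 ≤ z.re → z.re ≤ 1 → ‖f i z‖ ≤ C := fun i => (hf i i.2).2
  choose C hC using h2
  refine ⟨Differentiable.fun_sum fun i hi => (hf i hi).1, ∑ i, C i, fun z h0 h1 => ?_⟩
  refine (norm_sum_le _ _).trans ?_
  rw [← Finset.sum_coe_sort s fun i => ‖f i z‖]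
  exact Finset.sum_le_sum fun i _ => hC i z h0 h1

/-- The modulus of the exponential depends only on the real part of the exponent, which stays
bounded on the strip. -/
theorem StripRegular.suppPow (c : ℝ) (d : ℝ) (x : ℝ) :
    StripRegular fun z => QKD.suppPow (c * z + d) x := by
  by_cases hx : x = 0
  · simpa [QKD.suppPow, hx] using StripRegular.const 0
  · simp only [QKD.suppPow, hx, if_false]
    refine ⟨by fun_prop, Real.exp ((|c| + |d|) * |Real.log x|), fun z h0 h1 => ?_⟩
    rw [Complex.norm_exp]
    refine Real.exp_le_exp.2 ?_
    rw [Complex.re_mul_ofReal]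
    refine (le_abs_self _).trans ?_
    rw [abs_mul]
    refine mul_le_mul_of_nonneg_right ?_ (abs_nonneg _)
    rw [Complex.add_re, Complex.re_ofReal_mul, Complex.ofReal_re]
    refine (abs_add_le _ _).trans (add_le_add ?_ le_rfl)
    rw [abs_mul, abs_of_nonneg h0]
    exact mul_le_of_le_one_right (abs_nonneg _) h1

/-- The three lines theorem for functions with equal bounds raised to the interpolated powers. -/
theorem StripRegular.norm_le_interp {f : ℂ → ℂ} (hf : StripRegular f) {A B r : ℝ}
    (hr0 : 0 ≤ r) (hr1 : r ≤ 1)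
    (h0 : ∀ z : ℂ, z.re = 0 → ‖f z‖ ≤ A) (h1 : ∀ z : ℂ, z.re = 1 → ‖f z‖ ≤ B) :
    ‖f r‖ ≤ A ^ (1 - r) * B ^ r := by
  obtain ⟨hf, C, hC⟩ := hf
  have := Complex.HadamardThreeLines.norm_le_interp_of_mem_verticalClosedStrip₀₁' (f := f)
    (z := (r : ℂ)) (a := A) (b := B) ⟨by simpa using hr0, by simpa using hr1⟩ hf.diffContOnCl
    ⟨C, by rintro _ ⟨z, hz, rfl⟩; exact hC z hz.1 hz.2⟩ (fun z hz => h0 z hz) (fun z hz => h1 z hz)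
  simpa using this

variable {a b c : Type*}

/-- Matrix-valued functions with regular entries. -/
def MatStripRegular (F : ℂ → Matrix a b ℂ) : Prop := ∀ i j, StripRegular fun z => F z i j

theorem MatStripRegular.const (A : Matrix a b ℂ) : MatStripRegular fun _ => A :=
  fun i j => StripRegular.const (A i j)

theorem MatStripRegular.mul [Fintype b] {F : ℂ → Matrix a b ℂ} {G : ℂ → Matrix b c ℂ}
    (hF : MatStripRegular F) (hG : MatStripRegular G) : MatStripRegular fun z => F z * G z := by
  intro i j
  simp only [Matrix.mul_apply]
  exact StripRegular.sum fun k _ => (hF i k).mul (hG k j)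

theorem MatStripRegular.trace [Fintype a] {F : ℂ → Matrix a a ℂ} (hF : MatStripRegular F) :
    StripRegular fun z => (F z).trace := by
  simp only [Matrix.trace, Matrix.diag_apply]
  exact StripRegular.sum fun k _ => hF k k

theorem MatStripRegular.spectralFn [Fintype a] [DecidableEq a] {A : Matrix a a ℂ}
    (hA : A.IsHermitian) (c d : ℝ) :
    MatStripRegular fun z => spectralFn hA (suppPow (c * z + d)) := by
  intro i j
  simp only [spectralFn_apply]
  exact StripRegular.sum fun k _ =>
    ((StripRegular.const _).mul (StripRegular.suppPow c d _)).mul (StripRegular.const _)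

end Strip

/-! ### Powers of positive semidefinite matrices -/

section Powers

variable {a b : Type*} [Fintype a] [DecidableEq a] [Fintype b] {A : Matrix a a ℂ}

/-- Complex powers of a positive semidefinite matrix on its support. -/
def psdPow (hA : A.PosSemidef) (z : ℂ) : Matrix a a ℂ := spectralFn hA.1 (suppPow z)

theorem psdPow_mul (hA : A.PosSemidef) (z w : ℂ) :
    psdPow hA z * psdPow hA w = psdPow hA (z + w) := by
  simp only [psdPow, spectralFn_mul, suppPow_mul]

theorem psdPow_mul_of_add_eq (hA : A.PosSemidef) {z w u : ℂ} (h : z + w = u) :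
    psdPow hA z * psdPow hA w = psdPow hA u := by rw [psdPow_mul, h]

theorem psdPow_conjTranspose (hA : A.PosSemidef) (z : ℂ) :
    (psdPow hA z)ᴴ = psdPow hA (star z) := by
  simp only [psdPow, spectralFn_conjTranspose, star_suppPow]

theorem psdPow_one (hA : A.PosSemidef) : psdPow hA 1 = A := by
  rw [psdPow, spectralFn_congr_nonneg hA (fun x hx => suppPow_one hx), spectralFn_id]

theorem matrixPow_eq_psdPow (hA : A.PosSemidef) {r : ℝ} (hr : r ≠ 0) :
    matrixPow A r = psdPow hA r := by
  rw [matrixPow, cfc_eq_spectralFn hA.1, psdPow]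
  exact spectralFn_congr_nonneg hA fun x hx => (suppPow_ofReal hr hx).symm

theorem mul_psdPow_zero_of_ker (hA : A.PosSemidef) (B : Matrix b a ℂ)
    (hB : ∀ v : a → ℂ, A *ᵥ v = 0 → B *ᵥ v = 0) : B * psdPow hA 0 = B :=
  spectralFn_support_mul_of_ker hA.1 B hB _ fun _ hx => suppPow_zero hx

/-- An imaginary power is unitary on the support and zero on the kernel, hence a contraction. On the
boundary lines of the strip this is what lets such factors be dropped. -/
theorem frobSq_mul_psdPow_le (hA : A.PosSemidef) {z : ℂ} (hz : z.re = 0) (V : Matrix b a ℂ) :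
    frobSq (V * psdPow hA z) ≤ frobSq V :=
  frobSq_mul_spectralFn_le hA.1 _ (fun _ => norm_suppPow_le_one hz _) V

theorem frobSq_psdPow_mul_le (hA : A.PosSemidef) {z : ℂ} (hz : z.re = 0) (V : Matrix a b ℂ) :
    frobSq (psdPow hA z * V) ≤ frobSq V :=
  frobSq_spectralFn_mul_le hA.1 _ (fun _ => norm_suppPow_le_one hz _) V

theorem frobSq_psdPow (hA : A.PosSemidef) (z : ℂ) :
    frobSq (psdPow hA z) = (psdPow hA ((2 * z.re : ℝ) : ℂ)).trace.re := by
  rw [frobSq_eq_trace, psdPow_conjTranspose, psdPow_mul]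
  congr 3
  apply Complex.ext <;> simp [two_mul]

theorem psdPow_posSemidef (hA : A.PosSemidef) (r : ℝ) : (psdPow hA r).PosSemidef := by
  have e : (r : ℂ) = ((r / 2 : ℝ) : ℂ) + ((r / 2 : ℝ) : ℂ) := by push_cast; ring
  have h : (psdPow hA ((r / 2 : ℝ) : ℂ))ᴴ = psdPow hA ((r / 2 : ℝ) : ℂ) := by
    rw [psdPow_conjTranspose]; simp
  have := Matrix.posSemidef_conjTranspose_mul_self (psdPow hA ((r / 2 : ℝ) : ℂ))
  rwa [h, psdPow_mul, ← e] at this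

theorem MatStripRegular.psdPow (hA : A.PosSemidef) {g : ℂ → ℂ} (c d : ℝ)
    (hg : ∀ z, g z = c * z + d) : MatStripRegular fun z => QKD.psdPow hA (g z) := by
  simp only [hg]
  exact MatStripRegular.spectralFn hA.1 c d

theorem posSemidef_psdPow_mul_mul {B : Matrix a a ℂ} (hA : A.PosSemidef) (hB : B.PosSemidef)
    (r : ℝ) : (psdPow hA r * B * psdPow hA r).PosSemidef := by
  have := hB.conjTranspose_mul_mul_same (psdPow hA r)
  rwa [psdPow_conjTranspose, Complex.star_def, Complex.conj_ofReal] at this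

theorem psdPow_zero_mul_mul {B : Matrix a a ℂ} (hA : A.PosSemidef) (hB : B.PosSemidef)
    (h : ∀ v, A *ᵥ v = 0 → B *ᵥ v = 0) : psdPow hA 0 * B * psdPow hA 0 = B := by
  have h1 := mul_psdPow_zero_of_ker hA B h
  have h2 := congrArg Matrix.conjTranspose h1
  rw [Matrix.conjTranspose_mul, psdPow_conjTranspose, star_zero, hB.1.eq] at h2
  rw [h2, h1]

/-- Opposite powers of `A` combine to its support projection, which fixes `B` on both sides. This
undoes the sandwiching in the Rényi divergence. -/
theorem psdPow_mul_mul_cancel {B : Matrix a a ℂ} (hA : A.PosSemidef) (hB : B.PosSemidef)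
    (h : ∀ v, A *ᵥ v = 0 → B *ᵥ v = 0) {z w : ℂ} (hzw : z + w = 0) :
    psdPow hA z * (psdPow hA w * B * psdPow hA w) * psdPow hA z = B := by
  calc _ = psdPow hA z * psdPow hA w * B * (psdPow hA w * psdPow hA z) := by
        simp only [Matrix.mul_assoc]
    _ = B := by rw [psdPow_mul, psdPow_mul, add_comm w, hzw, psdPow_zero_mul_mul hA hB h]

end Powers

/-! ### Completely positive trace-preserving maps in Kraus form -/

section Kraus

variable {a b κ : Type*} [Fintype a] [Fintype b] [Fintype κ]

/-- The completely positive map `ρ ↦ ∑ K_k† ρ K_k`. -/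
def krausMap (K : κ → Matrix b a ℂ) (ρ : Matrix b b ℂ) : Matrix a a ℂ :=
  ∑ k, (K k)ᴴ * ρ * K k

theorem krausMap_posSemidef (K : κ → Matrix b a ℂ) {ρ : Matrix b b ℂ} (hρ : ρ.PosSemidef) :
    (krausMap K ρ).PosSemidef :=
  Matrix.posSemidef_sum _ fun k _ => hρ.conjTranspose_mul_mul_same (K k)

theorem trace_krausMap [DecidableEq b] {K : κ → Matrix b a ℂ} (hK : ∑ k, K k * (K k)ᴴ = 1)
    (ρ : Matrix b b ℂ) : (krausMap K ρ).trace = ρ.trace := by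
  rw [krausMap, Matrix.trace_sum]
  calc ∑ k, ((K k)ᴴ * ρ * K k).trace = ∑ k, (ρ * (K k * (K k)ᴴ)).trace := by
        refine Finset.sum_congr rfl fun k _ => ?_
        rw [Matrix.mul_assoc, Matrix.trace_mul_comm, Matrix.mul_assoc]
    _ = ρ.trace := by rw [← Matrix.trace_sum, ← Matrix.mul_sum, hK, Matrix.mul_one]

/-- For `v` in the kernel of the image of `σ`, the nonnegative terms `⟨K_k v, σ K_k v⟩` sum to zero,
so every `K_k v` lies in the kernel of `σ`. Finiteness of the divergence is thus preserved. -/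
theorem krausMap_ker (K : κ → Matrix b a ℂ) {σ ρ : Matrix b b ℂ} (hσ : σ.PosSemidef)
    (hs : ∀ v, σ *ᵥ v = 0 → ρ *ᵥ v = 0) (v : a → ℂ) (hv : krausMap K σ *ᵥ v = 0) :
    krausMap K ρ *ᵥ v = 0 := by
  have h0 : ∑ k, star (K k *ᵥ v) ⬝ᵥ (σ *ᵥ (K k *ᵥ v)) = 0 := by
    calc ∑ k, star (K k *ᵥ v) ⬝ᵥ (σ *ᵥ (K k *ᵥ v)) = star v ⬝ᵥ (krausMap K σ *ᵥ v) := by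
          rw [krausMap, Matrix.sum_mulVec, dotProduct_sum]
          refine Finset.sum_congr rfl fun k _ => ?_
          rw [Matrix.star_mulVec, ← Matrix.dotProduct_mulVec, Matrix.mulVec_mulVec,
            Matrix.mulVec_mulVec, Matrix.mul_assoc]
      _ = 0 := by rw [hv, dotProduct_zero]
  have h1 := (Finset.sum_eq_zero_iff_of_nonneg
    (fun k _ => hσ.dotProduct_mulVec_nonneg (K k *ᵥ v))).1 h0
  rw [krausMap, Matrix.sum_mulVec]
  refine Finset.sum_eq_zero fun k _ => ?_
  have h2 := (hσ.dotProduct_mulVec_zero_iff _).1 (h1 k (Finset.mem_univ k))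
  have h3 := hs _ h2
  rw [Matrix.mulVec_mulVec] at h3
  rw [Matrix.mul_assoc, ← Matrix.mulVec_mulVec, h3, Matrix.mulVec_zero]

end Kraus

/-! ### Data processing for the sandwiched Rényi divergence -/

section DataProcessing

variable {a b κ : Type*} [Fintype a] [DecidableEq a] [Fintype b] [DecidableEq b] [Fintype κ]

/-- Complex interpolation: the function `f` below is bounded by `Tr Y^α` on `re z = 0` and by `Tr
X^α` on `re z = 1`, and equals `Tr X^α` at `z = (α - 1) / α`. The three lines theorem bounds `Tr
X^α` by a geometric mean of `Tr Y^α` and itself; positivity allows cancellation. -/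
theorem trace_sandwiched_pow_le {K : κ → Matrix b a ℂ} (hK : ∑ k, K k * (K k)ᴴ = 1)
    {σ Y : Matrix b b ℂ} {T X : Matrix a a ℂ} (hσ : σ.PosSemidef) (hY : Y.PosSemidef)
    (hT : T.PosSemidef) (hX : X.PosSemidef) (hTσ : T = krausMap K σ) {α : ℝ} (hα : 1 < α)
    (hXY : psdPow hT (((1 - α) / (2 * α) : ℝ) : ℂ) *
        krausMap K (psdPow hσ (((α - 1) / (2 * α) : ℝ) : ℂ) * Y *
          psdPow hσ (((α - 1) / (2 * α) : ℝ) : ℂ)) *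
        psdPow hT (((1 - α) / (2 * α) : ℝ) : ℂ) = X)
    (hpos : 0 < (psdPow hX (α : ℂ)).trace.re) :
    (psdPow hX (α : ℂ)).trace.re ≤ (psdPow hY (α : ℂ)).trace.re := by
  have hα0 : α ≠ 0 := by positivity
  set qX := (psdPow hX (α : ℂ)).trace.re with hqX
  set qY := (psdPow hY (α : ℂ)).trace.re with hqY
  have hqY0 : 0 ≤ qY := posSemidef_trace_re_nonneg (psdPow_posSemidef hY α)
  let G : ℂ → κ → Matrix b a ℂ := fun z k =>
    psdPow hσ (z / 2) * K k * (psdPow hT (-z / 2) * psdPow hX (α * z / 2))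
  let f : ℂ → ℂ := fun z => ∑ k, ((psdPow hX (α * z / 2) * psdPow hT (-z / 2)) * (K k)ᴴ *
    psdPow hσ (z / 2) * psdPow hY (α * (1 - z)) * (psdPow hσ (z / 2) * K k *
      (psdPow hT (-z / 2) * psdPow hX (α * z / 2)))).trace
  have hreg : StripRegular f := by
    have r1 : MatStripRegular fun z => psdPow hX (α * z / 2) := 
      MatStripRegular.psdPow hX (α / 2) 0 fun z => by push_cast; ring
    have r2 : MatStripRegular fun z => psdPow hT (-z / 2) := 
      MatStripRegular.psdPow hT (-1 / 2) 0 fun z => by push_cast; ring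
    have r3 : MatStripRegular fun z => psdPow hσ (z / 2) := 
      MatStripRegular.psdPow hσ (1 / 2) 0 fun z => by push_cast; ring
    have r4 : MatStripRegular fun z => psdPow hY (α * (1 - z)) := 
      MatStripRegular.psdPow hY (-α) α fun z => by push_cast; ring
    exact StripRegular.sum fun k _ => (((((r1.mul r2).mul (.const _)).mul r3).mul r4).mul
      ((r3.mul (.const _)).mul (r2.mul r1))).trace
  -- Analyticity of `f` forbids conjugating `z`, so its left factor is the adjoint of `G` at the
  -- conjugate point. That point lies on the same boundary line, so both Cauchy–Schwarz factors obey
  -- the same bound.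
  have hGstar : ∀ z k, (psdPow hX (α * z / 2) * psdPow hT (-z / 2)) * (K k)ᴴ * psdPow hσ (z / 2) =
      (G (star z) k)ᴴ := by
    intro z k
    simp only [G, Matrix.conjTranspose_mul, psdPow_conjTranspose, Matrix.mul_assoc]
    simp
  have hf : ∀ z, f z = ∑ k, ((G (star z) k)ᴴ * (psdPow hY (α * (1 - z)) * G z k)).trace := by
    intro z
    refine Finset.sum_congr rfl fun k _ => ?_
    rw [hGstar]
    simp only [G, Matrix.mul_assoc]
  -- Here the power of `Y` is imaginary and drops out. The two half powers of `σ` combine to `σ`,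
  -- the Kraus sum turns it into `T`, and `T` cancels against `T^(-z/2)` up to an imaginary power.
  have bound1 : ∀ z : ℂ, z.re = 1 → ‖f z‖ ≤ qX := by
    have hG : ∀ z : ℂ, z.re = 1 → ∑ k, frobSq (G z k) ≤ qX := by
      intro z hz
      set R := psdPow hT (-z / 2) * psdPow hX (α * z / 2) with hR
      have e1 : ∑ k, frobSq (G z k) = frobSq (psdPow hT (1 / 2) * R) := by
        have e2 : ∀ k, (G z k)ᴴ * G z k = Rᴴ * ((K k)ᴴ * σ * K k) * R := by
          intro k
          have hh : psdPow hσ (star (z / 2)) * psdPow hσ (z / 2) = σ := by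
            rw [psdPow_mul_of_add_eq hσ (u := 1), psdPow_one]
            apply Complex.ext <;> simp [hz] <;> ring
          conv_rhs => rw [← hh]
          simp only [G, ← hR, Matrix.conjTranspose_mul, psdPow_conjTranspose, Matrix.mul_assoc]
        have e3 : (psdPow hT (1 / 2) * R)ᴴ * (psdPow hT (1 / 2) * R) = Rᴴ * T * R := by
          have hh : psdPow hT (star (1 / 2)) * psdPow hT (1 / 2) = T := by
            rw [psdPow_mul_of_add_eq hT (u := 1), psdPow_one]
            apply Complex.ext <;> simp; ring
          conv_rhs => rw [← hh]
          simp only [Matrix.conjTranspose_mul, psdPow_conjTranspose, Matrix.mul_assoc]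
        simp only [frobSq_eq_trace, e2, e3]
        rw [← Complex.re_sum, ← Matrix.trace_sum, ← Matrix.sum_mul, ← Matrix.mul_sum]
        conv_rhs => rw [hTσ]
        rfl
      rw [e1, hR, ← Matrix.mul_assoc, psdPow_mul]
      refine (frobSq_psdPow_mul_le hT (by simp [hz]; norm_num) _).trans ?_
      rw [frobSq_psdPow, hqX]
      refine le_of_eq ?_
      congr 3
      simp [hz]
      ring
    intro z hz
    rw [hf]
    refine (norm_sum_trace_conjTranspose_mul_le _ _).trans ?_
    have h1 := hG (star z) (by simpa using hz)
    have h2 : ∑ k, frobSq (psdPow hY (α * (1 - z)) * G z k) ≤ qX :=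
      (Finset.sum_le_sum fun k _ => frobSq_psdPow_mul_le hY (by simp [hz]) _).trans (hG z hz)
    calc _ ≤ Real.sqrt qX * Real.sqrt qX := by gcongr
      _ = qX := Real.mul_self_sqrt hpos.le
  -- Here the powers of `X`, `T` and `σ` are imaginary and drop out, and the Kraus operators
  -- disappear by `hK`. The power of `Y` is split evenly between the two Cauchy–Schwarz factors.
  have bound0 : ∀ z : ℂ, z.re = 0 → ‖f z‖ ≤ qY := by
    have hG : ∀ z : ℂ, z.re = 0 → ∑ k, frobSq (psdPow hY (α * (1 - z) / 2) * G z k) ≤ qY := by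
      intro z hz
      set N := psdPow hY (α * (1 - z) / 2) * psdPow hσ (z / 2) with hN
      have e1 : ∀ k, frobSq (psdPow hY (α * (1 - z) / 2) * G z k) ≤ frobSq (N * K k) := by
        intro k
        have : psdPow hY (α * (1 - z) / 2) * G z k =
            N * K k * psdPow hT (-z / 2) * psdPow hX (α * z / 2) := by
          simp only [G, hN, Matrix.mul_assoc]
        rw [this]
        exact (frobSq_mul_psdPow_le hX (by simp [hz]) _).trans
          (frobSq_mul_psdPow_le hT (by simp [hz]) _)
      refine (Finset.sum_le_sum fun k _ => e1 k).trans ?_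
      have e2 : ∑ k, frobSq (N * K k) = frobSq N := by
        simp only [frobSq_eq_trace']
        rw [← Complex.re_sum, ← Matrix.trace_sum]
        have : ∀ k, N * K k * (N * K k)ᴴ = N * (K k * (K k)ᴴ) * Nᴴ := fun k => by
          simp only [Matrix.conjTranspose_mul, Matrix.mul_assoc]
        simp only [this]
        rw [← Matrix.sum_mul, ← Matrix.mul_sum, hK, Matrix.mul_one]
      rw [e2, hN]
      refine (frobSq_mul_psdPow_le hσ (by simp [hz]) _).trans ?_
      rw [frobSq_psdPow, hqY]
      refine le_of_eq ?_
      congr 3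
      simp [hz]
      ring
    intro z hz
    have e : f z = ∑ k, ((psdPow hY (α * (1 - star z) / 2) * G (star z) k)ᴴ *
        (psdPow hY (α * (1 - z) / 2) * G z k)).trace := by
      rw [hf]
      refine Finset.sum_congr rfl fun k _ => ?_
      congr 1
      rw [Matrix.conjTranspose_mul (psdPow hY _), psdPow_conjTranspose, Matrix.mul_assoc,
        ← Matrix.mul_assoc (psdPow hY _) (psdPow hY _),
        psdPow_mul_of_add_eq hY (u := α * (1 - z))]
      simp
    rw [e]
    refine (norm_sum_trace_conjTranspose_mul_le _ _).trans ?_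
    have h1 := hG (star z) (by simpa using hz)
    have h2 := hG z hz
    calc _ ≤ Real.sqrt qY * Real.sqrt qY := by gcongr
      _ = qY := Real.mul_self_sqrt hqY0
  -- At this point `Y` has exponent one, the powers of `σ` and `T` are those in `hXY`, and `X` is
  -- multiplied by two powers of total exponent `α - 1`.
  have hr0 : 0 ≤ (α - 1) / α := div_nonneg (by linarith) (by linarith)
  have hr1 : (α - 1) / α < 1 := by rw [div_lt_one (by linarith)]; linarith
  have main := hreg.norm_le_interp hr0 hr1.le bound0 bound1
  have hval : f (((α - 1) / α : ℝ) : ℂ) = (psdPow hX (α : ℂ)).trace := by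
    have c1 : (((α - 1) / α : ℝ) : ℂ) / 2 = (((α - 1) / (2 * α) : ℝ) : ℂ) := by
      push_cast; field_simp
    have c2 : -(((α - 1) / α : ℝ) : ℂ) / 2 = (((1 - α) / (2 * α) : ℝ) : ℂ) := by
      push_cast; field_simp; ring
    have c3 : (α : ℂ) * (1 - (((α - 1) / α : ℝ) : ℂ)) = 1 := by
      push_cast; field_simp; ring
    have c4 : (α : ℂ) * (((α - 1) / α : ℝ) : ℂ) / 2 + ((α : ℂ) * (((α - 1) / α : ℝ) : ℂ) / 2 + 1)
        = α := by
      push_cast; field_simp; ring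
    simp only [f, c1, c2, c3, psdPow_one]
    rw [← Matrix.trace_sum]
    set Xh := psdPow hX ((α : ℂ) * (((α - 1) / α : ℝ) : ℂ) / 2) with hXh
    have : ∀ k, Xh * psdPow hT (((1 - α) / (2 * α) : ℝ) : ℂ) * (K k)ᴴ *
        psdPow hσ (((α - 1) / (2 * α) : ℝ) : ℂ) * Y *
        (psdPow hσ (((α - 1) / (2 * α) : ℝ) : ℂ) * K k *
          (psdPow hT (((1 - α) / (2 * α) : ℝ) : ℂ) * Xh)) =
        Xh * psdPow hT (((1 - α) / (2 * α) : ℝ) : ℂ) * ((K k)ᴴ *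
        (psdPow hσ (((α - 1) / (2 * α) : ℝ) : ℂ) * Y *
        psdPow hσ (((α - 1) / (2 * α) : ℝ) : ℂ)) * K k) *
          (psdPow hT (((1 - α) / (2 * α) : ℝ) : ℂ) * Xh) := fun k => by
      simp only [Matrix.mul_assoc]
    simp only [this]
    rw [← Matrix.sum_mul, ← Matrix.mul_sum, ← krausMap]
    have h2 : Xh * psdPow hT (((1 - α) / (2 * α) : ℝ) : ℂ) *
        krausMap K (psdPow hσ (((α - 1) / (2 * α) : ℝ) : ℂ) * Y *
          psdPow hσ (((α - 1) / (2 * α) : ℝ) : ℂ)) *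
        (psdPow hT (((1 - α) / (2 * α) : ℝ) : ℂ) * Xh) = Xh * X * Xh := by
      rw [← hXY]
      simp only [Matrix.mul_assoc]
    have h3 : X * Xh = psdPow hX (1 + (α : ℂ) * (((α - 1) / α : ℝ) : ℂ) / 2) := by
      rw [hXh, ← psdPow_mul, psdPow_one]
    rw [h2, Matrix.mul_assoc, h3, hXh, psdPow_mul_of_add_eq hX (u := α)]
    linear_combination c4
  rw [hval] at main
  have h5 : qX ≤ qY ^ (1 - (α - 1) / α) * qX ^ ((α - 1) / α) :=
    (Complex.re_le_norm _).trans main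
  have h6 : qX = qX ^ (1 - (α - 1) / α) * qX ^ ((α - 1) / α) := by
    rw [← Real.rpow_add hpos]; simp
  rw [h6] at h5
  have h7 : qX ^ (1 - (α - 1) / α) ≤ qY ^ (1 - (α - 1) / α) :=
    le_of_mul_le_mul_right (by rwa [← h6] at h5 ⊢) (Real.rpow_pos_of_pos hpos _)
  exact (Real.rpow_le_rpow_iff hpos.le hqY0 (by linarith)).1 h7

/-- Monotonicity of the sandwiched Rényi divergence under completely positive trace-preserving
maps. -/
theorem sandwichedDivergence_krausMap_le {K : κ → Matrix b a ℂ} (hK : ∑ k, K k * (K k)ᴴ = 1)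
    {ρ σ : Matrix b b ℂ} (hρ : ρ.PosSemidef) (hρ1 : 0 < ρ.trace.re) (hσ : σ.PosSemidef) {α : ℝ}
    (hα : 1 < α) :
    sandwichedDivergence α (krausMap K ρ) (krausMap K σ) ≤ sandwichedDivergence α ρ σ := by
  by_cases hs : ∀ v, σ *ᵥ v = 0 → ρ *ᵥ v = 0
  swap
  · rw [sandwichedDivergence, sandwichedDivergence, if_neg hs]
    exact le_top
  have hs' := krausMap_ker K hσ hs
  rw [sandwichedDivergence, sandwichedDivergence, if_pos hs, if_pos hs', EReal.coe_le_coe_iff,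
    trace_krausMap hK]
  have hα0 : α ≠ 0 := by positivity
  have hr : (1 - α) / (2 * α) ≠ 0 := div_ne_zero (by linarith) (by positivity)
  have hT := krausMap_posSemidef K hσ
  have hΦ := krausMap_posSemidef K hρ
  have hY := posSemidef_psdPow_mul_mul hσ hρ ((1 - α) / (2 * α))
  have hX := posSemidef_psdPow_mul_mul hT hΦ ((1 - α) / (2 * α))
  rw [matrixPow_eq_psdPow hσ hr, matrixPow_eq_psdPow hT hr, matrixPow_eq_psdPow hY hα0,
    matrixPow_eq_psdPow hX hα0]
  have c1 : (((α - 1) / (2 * α) : ℝ) : ℂ) + (((1 - α) / (2 * α) : ℝ) : ℂ) = 0 := by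
    push_cast; ring
  -- If the trace vanished, the sandwiched output operator would vanish. Undoing the sandwiching
  -- would give `krausMap K ρ = 0`, against preservation of the positive trace of `ρ`.
  have hposX : 0 < (psdPow hX (α : ℂ)).trace.re := by
    refine lt_of_le_of_ne (posSemidef_trace_re_nonneg (psdPow_posSemidef hX α)) fun h0 => ?_
    have h1 : (psdPow hX (α : ℂ)) = 0 := by
      have hp := psdPow_posSemidef hX α
      refine hp.trace_eq_zero_iff.1 ?_
      have := (Complex.le_def.1 hp.trace_nonneg).2
      exact Complex.ext h0.symm this.symm
    have h2 : psdPow hX 0 = 0 := by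
      rw [← psdPow_mul_of_add_eq hX (show (α : ℂ) + (-α : ℂ) = 0 by ring), h1, Matrix.zero_mul]
    have h3 := mul_psdPow_zero_of_ker hX _ (fun v h => h)
    rw [h2, Matrix.mul_zero] at h3
    have h5 : krausMap K ρ = 0 := by
      rw [← psdPow_mul_mul_cancel hT hΦ hs' c1, ← h3, Matrix.mul_zero, Matrix.zero_mul]
    have h6 := trace_krausMap hK ρ
    rw [h5, Matrix.trace_zero] at h6
    rw [← h6] at hρ1
    simp at hρ1
  have := trace_sandwiched_pow_le hK hσ hY hT hX rfl hα
    (by rw [psdPow_mul_mul_cancel hσ hρ hs c1]) hposX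
  refine mul_le_mul_of_nonneg_left ?_ (by apply div_nonneg <;> linarith)
  refine Real.logb_le_logb_of_le one_lt_two (div_pos hposX hρ1) ?_
  exact div_le_div_of_nonneg_right this hρ1.le

end DataProcessing

/-! ### Monotonicity of the fidelity -/

section Fidelity

variable {a b c κ : Type*} [Fintype a] [DecidableEq a] [Fintype b] [DecidableEq b] [Fintype c]
  [Fintype κ]

theorem cfc_sqrt_eq_psdPow {A : Matrix a a ℂ} (hA : A.PosSemidef) :
    cfc Real.sqrt A = psdPow hA (1 / 2) := by
  have h : ((1 / 2 : ℝ) : ℂ) = 1 / 2 := by push_cast; ring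
  rw [← h, ← matrixPow_eq_psdPow hA (by norm_num), matrixPow]
  congr 1
  funext x
  exact Real.sqrt_eq_rpow x

theorem psdPow_half_mul_half {A : Matrix a a ℂ} (hA : A.PosSemidef) :
    psdPow hA (1 / 2) * psdPow hA (1 / 2) = A := by
  rw [psdPow_mul_of_add_eq hA (u := 1) (by norm_num), psdPow_one]

theorem psdPow_half_conjTranspose {A : Matrix a a ℂ} (hA : A.PosSemidef) :
    (psdPow hA (1 / 2))ᴴ = psdPow hA (1 / 2) := by
  rw [psdPow_conjTranspose]
  simp

theorem one_sub_psdPow_zero_posSemidef {A : Matrix a a ℂ} (hA : A.PosSemidef) :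
    (1 - psdPow hA 0).PosSemidef := by
  have h1 : (psdPow hA 0)ᴴ = psdPow hA 0 := by simp [psdPow_conjTranspose]
  have h2 : psdPow hA 0 * psdPow hA 0 = psdPow hA 0 := psdPow_mul_of_add_eq hA (by simp)
  have := Matrix.posSemidef_conjTranspose_mul_self (1 - psdPow hA 0)
  rwa [Matrix.conjTranspose_sub, h1, Matrix.conjTranspose_one, Matrix.sub_mul, Matrix.mul_sub,
    Matrix.mul_sub, h2, Matrix.one_mul, Matrix.mul_one, sub_self, sub_zero, Matrix.one_mul] at this

/-- If `A† A ≤ R`, then `A = V √R` for a contraction `V`. -/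
theorem exists_contraction_mul_sqrt (A : Matrix c a ℂ) {R : Matrix a a ℂ} (hR : R.PosSemidef)
    (h : (R - Aᴴ * A).PosSemidef) :
    ∃ V : Matrix c a ℂ, (1 - Vᴴ * V).PosSemidef ∧ A = V * psdPow hR (1 / 2) ∧
      V = A * psdPow hR (-(1 / 2)) := by
  -- Conjugating `A† A ≤ R` by `R^(-1/2)` bounds `V† V` by the support projection of `R`. The same
  -- inequality puts the kernel of `R` inside that of `A`, so `V √R = A`.
  refine ⟨A * psdPow hR (-(1 / 2)), ?_, ?_, rfl⟩
  · have hS : (psdPow hR (-(1 / 2)))ᴴ = psdPow hR (-(1 / 2)) := by simp [psdPow_conjTranspose]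
    have h1 := h.conjTranspose_mul_mul_same (psdPow hR (-(1 / 2)))
    rw [hS, Matrix.mul_sub, Matrix.sub_mul] at h1
    have h2 : psdPow hR (-(1 / 2)) * R * psdPow hR (-(1 / 2)) = psdPow hR 0 := by
      have : psdPow hR (-(1 / 2)) * psdPow hR 1 * psdPow hR (-(1 / 2)) = psdPow hR 0 := by
        rw [psdPow_mul, psdPow_mul]
        norm_num
      rwa [psdPow_one] at this
    rw [h2] at h1
    have h3 := (one_sub_psdPow_zero_posSemidef hR).add h1
    rw [sub_add_sub_cancel] at h3
    rw [Matrix.conjTranspose_mul, hS]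
    simpa only [Matrix.mul_assoc] using h3
  · rw [Matrix.mul_assoc, psdPow_mul_of_add_eq hR (u := 0) (by norm_num),
      mul_psdPow_zero_of_ker hR]
    intro v hv
    have h1 := h.dotProduct_mulVec_nonneg v
    rw [Matrix.sub_mulVec, hv, zero_sub, dotProduct_neg, ← Matrix.mulVec_mulVec,
      Matrix.dotProduct_mulVec, ← Matrix.star_mulVec, Left.nonneg_neg_iff] at h1
    exact dotProduct_star_self_eq_zero.1 (le_antisymm h1 (dotProduct_star_self_nonneg _))

theorem traceNorm_eq (M : Matrix a a ℂ) :
    traceNorm M =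
      (psdPow (Matrix.posSemidef_conjTranspose_mul_self M) (1 / 2)).trace.re := by
  rw [traceNorm, cfc_sqrt_eq_psdPow]

theorem traceNorm_nonneg (M : Matrix a a ℂ) : 0 ≤ traceNorm M := by
  rw [traceNorm_eq]
  have := psdPow_posSemidef (Matrix.posSemidef_conjTranspose_mul_self M) (1 / 2)
  push_cast at this
  exact posSemidef_trace_re_nonneg this

/-- The polar part `M |M|⁻¹`, with the inverse taken on the support, satisfies `W† M = |M|`. -/
theorem exists_contraction_trace_eq_traceNorm (M : Matrix a a ℂ) :
    ∃ W : Matrix a a ℂ, (1 - Wᴴ * W).PosSemidef ∧ (Wᴴ * M).trace.re = traceNorm M := by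
  have hM := Matrix.posSemidef_conjTranspose_mul_self M
  obtain ⟨V, hV, -, hV'⟩ := exists_contraction_mul_sqrt M hM (by simpa using Matrix.PosSemidef.zero)
  refine ⟨V, hV, ?_⟩
  have hS : (psdPow hM (-(1 / 2)))ᴴ = psdPow hM (-(1 / 2)) := by simp [psdPow_conjTranspose]
  have h1 : psdPow hM (-(1 / 2)) * (Mᴴ * M) = psdPow hM (1 / 2) := by
    have : psdPow hM (-(1 / 2)) * psdPow hM 1 = psdPow hM (1 / 2) :=
      psdPow_mul_of_add_eq hM (by norm_num)
    rwa [psdPow_one] at this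
  rw [hV', Matrix.conjTranspose_mul, hS, Matrix.mul_assoc, h1, traceNorm_eq]

/-- Write `M = U |M|` with `U` a contraction, put one factor `|M|^(1/2)`, that is `(M† M)^(1/4)`, on
each side, and apply Cauchy–Schwarz. Two contractions into a larger space are allowed because the
dilations used for the fidelity produce such a pair. -/
theorem trace_contraction_mul_le_traceNorm (M : Matrix a a ℂ) {V W : Matrix c a ℂ}
    (hV : (1 - Vᴴ * V).PosSemidef) (hW : (1 - Wᴴ * W).PosSemidef) :
    (Vᴴ * W * M).trace.re ≤ traceNorm M := by
  have hM := Matrix.posSemidef_conjTranspose_mul_self M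
  obtain ⟨U, hU, hMU, -⟩ := exists_contraction_mul_sqrt M hM
    (by simpa using Matrix.PosSemidef.zero)
  have hH : (psdPow hM (1 / 4))ᴴ = psdPow hM (1 / 4) := by simp [psdPow_conjTranspose]
  have hHH : psdPow hM (1 / 4) * psdPow hM (1 / 4) = psdPow hM (1 / 2) :=
    psdPow_mul_of_add_eq hM (by norm_num)
  have e : (Vᴴ * W * M).trace =
      ((V * psdPow hM (1 / 4))ᴴ * (W * (U * psdPow hM (1 / 4)))).trace := by
    conv_lhs => rw [hMU, ← hHH]
    rw [Matrix.conjTranspose_mul, hH, Matrix.mul_assoc (psdPow hM (1 / 4)),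
      Matrix.trace_mul_comm (psdPow hM (1 / 4))]
    simp only [Matrix.mul_assoc]
  have hq : frobSq (psdPow hM (1 / 4)) = traceNorm M := by
    rw [frobSq_eq_trace, hH, hHH, traceNorm_eq]
  rw [e]
  refine (Complex.re_le_norm _).trans ((norm_trace_conjTranspose_mul_le _ _).trans ?_)
  have h1 : frobSq (V * psdPow hM (1 / 4)) ≤ traceNorm M :=
    (frobSq_mul_le_of_contraction _ _ hV).trans hq.le
  have h2 : frobSq (W * (U * psdPow hM (1 / 4))) ≤ traceNorm M :=
    (frobSq_mul_le_of_contraction _ _ hW).trans ((frobSq_mul_le_of_contraction _ _ hU).trans hq.le)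
  calc _ ≤ Real.sqrt (traceNorm M) * Real.sqrt (traceNorm M) := by gcongr
    _ = traceNorm M := Real.mul_self_sqrt (traceNorm_nonneg M)

theorem krausMap_sub (K : κ → Matrix b a ℂ) (ρ σ : Matrix b b ℂ) :
    krausMap K (ρ - σ) = krausMap K ρ - krausMap K σ := by
  simp only [krausMap, Matrix.mul_sub, Matrix.sub_mul, Finset.sum_sub_distrib]

/-- The fidelity does not decrease under completely positive trace-preserving maps. -/
theorem traceNorm_sqrt_mul_sqrt_le_krausMap {K : κ → Matrix b a ℂ}
    (hK : ∑ k, K k * (K k)ᴴ = 1) {ρ σ : Matrix b b ℂ} (hρ : ρ.PosSemidef) (hσ : σ.PosSemidef) :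
    traceNorm (cfc Real.sqrt ρ * cfc Real.sqrt σ) ≤
      traceNorm (cfc Real.sqrt (krausMap K ρ) * cfc Real.sqrt (krausMap K σ)) := by
  have hρ' := krausMap_posSemidef K hρ
  have hσ' := krausMap_posSemidef K hσ
  rw [cfc_sqrt_eq_psdPow hρ, cfc_sqrt_eq_psdPow hσ, cfc_sqrt_eq_psdPow hρ', cfc_sqrt_eq_psdPow hσ']
  obtain ⟨W, hW, hWM⟩ :=
    exists_contraction_trace_eq_traceNorm (psdPow hρ (1 / 2) * psdPow hσ (1 / 2))
  rw [← hWM]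
  -- The fidelity becomes `Tr A† B` with `A† A ≤ σ` and `B† B = ρ`, a form that survives dilation.
  set A := W * psdPow hσ (1 / 2) with hA
  set B := psdPow hρ (1 / 2) with hB
  have hAσ : (σ - Aᴴ * A).PosSemidef := by
    have := hW.conjTranspose_mul_mul_same (psdPow hσ (1 / 2))
    rw [Matrix.mul_sub, Matrix.sub_mul, Matrix.mul_one, psdPow_half_conjTranspose,
      psdPow_half_mul_half] at this
    rw [hA, Matrix.conjTranspose_mul, psdPow_half_conjTranspose]
    simpa only [Matrix.mul_assoc] using this
  have hBρ : (ρ - Bᴴ * B).PosSemidef := by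
    rw [hB, psdPow_half_conjTranspose, psdPow_half_mul_half, sub_self]
    exact Matrix.PosSemidef.zero
  -- The Stinespring picture: stacking the blocks `C K_k` makes inner products of stacks equal to
  -- the image of `C† D` under the channel. Both stacks then factor through square roots of the
  -- output operators.
  let stack : Matrix b b ℂ → Matrix (κ × b) a ℂ := fun C => Matrix.of fun x j => (C * K x.1) x.2 j
  have hstack : ∀ C D : Matrix b b ℂ, (stack C)ᴴ * stack D = krausMap K (Cᴴ * D) := by
    intro C D
    have : ∀ k, (K k)ᴴ * (Cᴴ * D) * K k = (C * K k)ᴴ * (D * K k) := fun k => by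
      simp only [Matrix.conjTranspose_mul, Matrix.mul_assoc]
    simp only [krausMap, this]
    ext i j
    simp only [Matrix.sum_apply, Matrix.mul_apply (M := (stack C)ᴴ),
      Matrix.mul_apply (M := (C * K _)ᴴ), Fintype.sum_prod_type, Matrix.conjTranspose_apply]
    rfl
  obtain ⟨V₁, hV₁, hV₁A, -⟩ := exists_contraction_mul_sqrt (stack A) hσ' (by
    rw [hstack, ← krausMap_sub]
    exact krausMap_posSemidef K hAσ)
  obtain ⟨V₂, hV₂, hV₂B, -⟩ := exists_contraction_mul_sqrt (stack B) hρ' (by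
    rw [hstack, ← krausMap_sub]
    exact krausMap_posSemidef K hBρ)
  have e1 : (Wᴴ * (B * psdPow hσ (1 / 2))).trace = (Aᴴ * B).trace := by
    rw [hA, Matrix.conjTranspose_mul, psdPow_half_conjTranspose, Matrix.mul_assoc,
      Matrix.trace_mul_comm (psdPow hσ (1 / 2)), Matrix.mul_assoc]
  have e2 : (V₁ᴴ * V₂ * (psdPow hρ' (1 / 2) * psdPow hσ' (1 / 2))).trace =
      ((stack A)ᴴ * stack B).trace := by
    rw [hV₁A, hV₂B, Matrix.conjTranspose_mul, psdPow_half_conjTranspose, Matrix.mul_assoc _ (V₁ᴴ),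
      Matrix.trace_mul_comm (psdPow hσ' (1 / 2))]
    simp only [Matrix.mul_assoc]
  rw [e1, ← trace_krausMap hK, ← hstack, ← e2]
  exact trace_contraction_mul_le_traceNorm _ hV₁ hV₂

/-- The purified distance does not increase under completely positive trace-preserving maps. -/
theorem purifiedDistance_krausMap_le {K : κ → Matrix b a ℂ}
    (hK : ∑ k, K k * (K k)ᴴ = 1) {ρ σ : Matrix b b ℂ} (hρ : ρ.PosSemidef) (hσ : σ.PosSemidef) :
    purifiedDistance (krausMap K ρ) (krausMap K σ) ≤ purifiedDistance ρ σ := by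
  have h0 : 0 ≤ generalizedFidelity ρ σ :=
    add_nonneg (traceNorm_nonneg _) (Real.sqrt_nonneg _)
  have h1 : generalizedFidelity ρ σ ≤ generalizedFidelity (krausMap K ρ) (krausMap K σ) := by
    simp only [generalizedFidelity, trace_krausMap hK]
    gcongr
    exact traceNorm_sqrt_mul_sqrt_le_krausMap hK hρ hσ
  unfold purifiedDistance
  gcongr

end Fidelity

/-! ### Conditional entropies under maps on the conditioning system -/

section ConditionalEntropy

variable {a b c κ : Type*} [Fintype a] [DecidableEq a] [Fintype b] [DecidableEq b]
  [Fintype c] [DecidableEq c] [Fintype κ]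

theorem sum_one_kronecker_mul_conjTranspose {L : κ → Matrix b c ℂ} (hL : ∑ k, L k * (L k)ᴴ = 1) :
    ∑ k, ((1 : Matrix a a ℂ) ⊗ₖ L k) * ((1 : Matrix a a ℂ) ⊗ₖ L k)ᴴ = 1 := by
  simp only [Matrix.conjTranspose_kronecker, Matrix.conjTranspose_one, ← Matrix.mul_kronecker_mul,
    Matrix.one_mul]
  rw [← Matrix.one_kronecker_one, ← hL]
  ext i j
  simp [Matrix.sum_apply, Matrix.kroneckerMap_apply, Finset.mul_sum]

theorem krausMap_one_kronecker (L : κ → Matrix b c ℂ) (σ : Matrix b b ℂ) :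
    krausMap (fun k => (1 : Matrix a a ℂ) ⊗ₖ L k) ((1 : Matrix a a ℂ) ⊗ₖ σ) =
      (1 : Matrix a a ℂ) ⊗ₖ krausMap L σ := by
  simp only [krausMap, Matrix.conjTranspose_kronecker, Matrix.conjTranspose_one,
    ← Matrix.mul_kronecker_mul, Matrix.one_mul]
  ext i j
  simp [Matrix.sum_apply, Matrix.kroneckerMap_apply, Finset.mul_sum]

theorem one_kronecker_posSemidef {σ : Matrix b b ℂ} (hσ : σ.PosSemidef) :
    ((1 : Matrix a a ℂ) ⊗ₖ σ).PosSemidef :=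
  Matrix.PosSemidef.one.kronecker hσ

theorem krausMap_isState {L : κ → Matrix b c ℂ} (hL : ∑ k, L k * (L k)ᴴ = 1) {σ : Matrix b b ℂ}
    (hσ : IsState σ) : IsState (krausMap L σ) :=
  ⟨krausMap_posSemidef L hσ.1, by rw [trace_krausMap hL, hσ.2]⟩

/-- The sandwiched Rényi conditional entropy does not decrease when the conditioning system is
processed. -/
theorem renyiEntropyUp_le_krausMap {L : κ → Matrix b c ℂ} (hL : ∑ k, L k * (L k)ᴴ = 1)
    {ρ : Matrix (a × b) (a × b) ℂ} (hρ : ρ.PosSemidef) (hρ1 : 0 < ρ.trace.re) {α : ℝ}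
    (hα : 1 < α) :
    renyiEntropyUp α ρ ≤
      renyiEntropyUp α (krausMap (fun k => (1 : Matrix a a ℂ) ⊗ₖ L k) ρ) := by
  refine iSup_le fun σ => ?_
  -- Each candidate `σ` on the old conditioning system is sent through the channel to a candidate on
  -- the new one.
  refine le_trans ?_ (le_iSup _ (⟨krausMap L σ.1, krausMap_isState hL σ.2⟩ :
    {σ : Matrix c c ℂ // IsState σ}))
  rw [EReal.neg_le_neg_iff, ← krausMap_one_kronecker]
  exact sandwichedDivergence_krausMap_le (sum_one_kronecker_mul_conjTranspose hL) hρ hρ1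
    (one_kronecker_posSemidef σ.2.1) hα

/-- The smooth min-entropy does not decrease when the conditioning system is processed. -/
theorem smoothMinEntropy_le_krausMap {L : κ → Matrix b c ℂ} (hL : ∑ k, L k * (L k)ᴴ = 1)
    {ρ : Matrix (a × b) (a × b) ℂ} (hρ : ρ.PosSemidef) (ε : ℝ) :
    smoothMinEntropy ε ρ ≤
      smoothMinEntropy ε (krausMap (fun k => (1 : Matrix a a ℂ) ⊗ₖ L k) ρ) := by
  have hK := sum_one_kronecker_mul_conjTranspose (a := a) hL
  refine sSup_le_sSup ?_
  rintro l ⟨r, rfl, ρ', hρ', hd, Y, hY, hle, htr⟩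
  -- All witnesses are pushed through the channel, which preserves operator inequalities and traces
  -- and contracts the purified distance.
  refine ⟨r, rfl, krausMap (fun k => (1 : Matrix a a ℂ) ⊗ₖ L k) ρ',
    ⟨krausMap_posSemidef _ hρ'.1, ?_⟩, (purifiedDistance_krausMap_le hK hρ'.1 hρ).trans hd,
    krausMap L Y, krausMap_posSemidef L hY, ?_, ?_⟩
  · rw [trace_krausMap hK]
    exact hρ'.2
  · rw [← krausMap_one_kronecker, ← krausMap_sub]
    exact krausMap_posSemidef _ hle
  · rwa [trace_krausMap hL]

end ConditionalEntropy

/-! ### Entropies of block-diagonal operators -/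

section BlockEntropy

variable {a e o : Type*} [Fintype a] [DecidableEq a] [Fintype e] [DecidableEq e]
  [Fintype o] [DecidableEq o]

/-- Passing to the characteristic polynomial makes the trace visibly invariant under reindexing and
additive over blocks, with no need to match eigenbases. -/
theorem trace_cfc_eq_sum_roots {A : Matrix a a ℂ} (hA : A.IsHermitian) (f : ℝ → ℝ) :
    (cfc f A).trace.re = (A.charpoly.roots.map fun z => f z.re).sum := by
  rw [trace_cfc hA, hA.roots_charpoly_eq_eigenvalues, Multiset.map_map, Complex.re_sum]
  simp

theorem charpoly_blockDiagonal (M : o → Matrix e e ℂ) :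
    (Matrix.blockDiagonal M).charpoly = ∏ k, (M k).charpoly := by
  simp only [Matrix.charpoly]
  rw [← Matrix.det_blockDiagonal]
  congr 1
  ext ⟨i, k⟩ ⟨j, l⟩
  by_cases hk : k = l <;> by_cases hi : i = j <;>
    simp [Matrix.blockDiagonal_apply, hk, hi]

theorem vonNeumannEntropy_of_blocks (φ : a ≃ e × o) (M : o → Matrix e e ℂ)
    (hM : ∀ k, (M k).IsHermitian) (A : Matrix a a ℂ)
    (hA : ∀ x y, A x y = if (φ x).2 = (φ y).2 then M (φ x).2 (φ x).1 (φ y).1 else 0) :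
    vonNeumannEntropy A = (∑ k, (cfc Real.negMulLog (M k)).trace.re) / Real.log 2 := by
  have e1 : A = Matrix.reindex φ.symm φ.symm (Matrix.blockDiagonal M) := by
    ext x y
    rw [hA]
    simp [Matrix.blockDiagonal_apply]
  have hB : (Matrix.blockDiagonal M).IsHermitian := by
    rw [Matrix.IsHermitian, Matrix.blockDiagonal_conjTranspose]
    congr 1
    funext k
    exact hM k
  have hAh : A.IsHermitian := by
    rw [e1]
    exact hB.submatrix _
  rw [vonNeumannEntropy, trace_cfc_eq_sum_roots hAh, e1, Matrix.charpoly_reindex,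
    charpoly_blockDiagonal, Polynomial.roots_prod _ _
      (Finset.prod_ne_zero_iff.2 fun k _ => (Matrix.charpoly_monic (M k)).ne_zero)]
  simp only [trace_cfc_eq_sum_roots (hM _), Multiset.map_bind, Multiset.sum_bind]
  rfl

/-- Apply `-(qx) log (qx) = q (-x log x) + x (-q log q)` to each eigenvalue `x`. -/
theorem trace_cfc_negMulLog_smul {A : Matrix a a ℂ} (hA : A.IsHermitian) (q : ℝ) :
    (cfc Real.negMulLog ((q : ℂ) • A)).trace.re =
      q * (cfc Real.negMulLog A).trace.re + A.trace.re * Real.negMulLog q := by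
  have h1 : cfc Real.negMulLog ((q : ℂ) • A) = cfc (fun x => Real.negMulLog (q • x)) A := by
    have h0 : (q : ℂ) • A = q • A := by
      ext i j
      simp
    rw [h0]
    exact (cfc_comp_smul q Real.negMulLog A Real.continuous_negMulLog.continuousOn hA).symm
  have h2 : A.trace = ∑ i, (hA.eigenvalues i : ℂ) := by
    conv_lhs => rw [← spectralFn_id hA, trace_spectralFn]
  rw [h1, trace_cfc hA, trace_cfc hA, h2]
  simp only [Complex.re_sum, Complex.ofReal_re, smul_eq_mul, Real.negMulLog_mul,
    Finset.sum_add_distrib, Finset.mul_sum, Finset.sum_mul]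
  rw [add_comm]

theorem trace_cfc_negMulLog_zero : (cfc Real.negMulLog (0 : Matrix a a ℂ)).trace.re = 0 := by
  simp

end BlockEntropy

/-! ### Vanishing conditional mutual information from conditional independence -/

section MarkovChain

variable {A B C L e : Type*} [Fintype A] [DecidableEq A] [Fintype B] [DecidableEq B]
  [Fintype C] [DecidableEq C] [Fintype L] [DecidableEq L] [Fintype e] [DecidableEq e]

/-- If, conditioned on the classical label `l`, the classical register `C` is independent of all
other registers, then the conditional mutual information vanishes. -/
theorem condMutualInfo_eq_zero_of_conditionally_independent
    (q : L → C → ℝ) (τ : A → B → L → Matrix e e ℂ) (hτ : ∀ a b l, (τ a b l).IsHermitian)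
    (hq : ∀ l, ∑ c, q l c = 1 ∨ ∀ a b, τ a b l = 0)
    (ρ : Matrix (A × (B × (e × L)) × C) (A × (B × (e × L)) × C) ℂ)
    (hρ : ∀ a b u l c a' b' v l' c', ρ (a, (b, (u, l)), c) (a', (b', (v, l')), c') =
      if a = a' ∧ b = b' ∧ l = l' ∧ c = c' then (q l c : ℂ) * τ a b l u v else 0) :
    condMutualInfo ρ = 0 := by
  have hq1 : ∀ a b l, (∑ c, q l c : ℂ) • τ a b l = τ a b l := by
    intro a b l
    rcases hq l with h | h
    · have : (∑ c, q l c : ℂ) = 1 := by exact_mod_cast h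
      rw [this, one_smul]
    · rw [h, smul_zero]
  have hτs : ∀ b l, (∑ a, τ a b l).IsHermitian := fun b l => by
    rw [Matrix.IsHermitian, Matrix.conjTranspose_sum]
    exact Finset.sum_congr rfl fun a _ => hτ a b l
  have hsm : ∀ {M : Matrix e e ℂ} (r : ℝ), M.IsHermitian → ((r : ℂ) • M).IsHermitian := by
    intro M r hM
    rw [Matrix.IsHermitian, Matrix.conjTranspose_smul, hM.eq]
    simp
  -- These equivalences isolate the only quantum register `e`; the classical registers together
  -- index the blocks.
  let φ4 : A × (B × (e × L)) × C ≃ e × (A × B × L × C) :=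
    ⟨fun x => (x.2.1.2.1, x.1, x.2.1.1, x.2.1.2.2, x.2.2),
      fun x => (x.2.1, (x.2.2.1, (x.1, x.2.2.2.1)), x.2.2.2.2), fun _ => rfl, fun _ => rfl⟩
  let φ1 : A × (B × (e × L)) ≃ e × (A × B × L) :=
    ⟨fun x => (x.2.2.1, x.1, x.2.1, x.2.2.2),
      fun x => (x.2.1, (x.2.2.1, (x.1, x.2.2.2))), fun _ => rfl, fun _ => rfl⟩
  let φ2 : (B × (e × L)) × C ≃ e × (B × L × C) :=
    ⟨fun x => (x.1.2.1, x.1.1, x.1.2.2, x.2),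
      fun x => ((x.2.1, (x.1, x.2.2.1)), x.2.2.2), fun _ => rfl, fun _ => rfl⟩
  let φ3 : B × (e × L) ≃ e × (B × L) :=
    ⟨fun x => (x.2.1, x.1, x.2.2), fun x => (x.2.1, (x.1, x.2.2)), fun _ => rfl, fun _ => rfl⟩
  have h4 := vonNeumannEntropy_of_blocks φ4 (fun x => (q x.2.2.1 x.2.2.2 : ℂ) • τ x.1 x.2.1 x.2.2.1)
    (fun x => hsm _ (hτ _ _ _)) ρ (by
      rintro ⟨a, ⟨b, u, l⟩, c⟩ ⟨a', ⟨b', v, l'⟩, c'⟩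
      rw [hρ]
      simp [φ4])
  have h1 := vonNeumannEntropy_of_blocks φ1 (fun x => τ x.1 x.2.1 x.2.2)
    (fun x => hτ _ _ _) (traceRight (ρ.submatrix (Equiv.prodAssoc A (B × (e × L)) C)
      (Equiv.prodAssoc A (B × (e × L)) C))) (by
      rintro ⟨a, b, u, l⟩ ⟨a', b', v, l'⟩
      simp only [traceRight, Matrix.of_apply, Matrix.submatrix_apply, Equiv.prodAssoc_apply, hρ, φ1,
        Equiv.coe_fn_mk, Prod.mk.injEq, and_true]
      split_ifs with h
      · rw [← Finset.sum_mul]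
        exact congr_fun (congr_fun (hq1 a b l) u) v
      · simp)
  have h2 := vonNeumannEntropy_of_blocks φ2 (fun x => (q x.2.1 x.2.2 : ℂ) • ∑ a, τ a x.1 x.2.1)
    (fun x => hsm _ (hτs _ _)) (traceLeft ρ) (by
      rintro ⟨⟨b, u, l⟩, c⟩ ⟨⟨b', v, l'⟩, c'⟩
      simp only [traceLeft, Matrix.of_apply, hρ, φ2,
        Equiv.coe_fn_mk, Prod.mk.injEq, true_and, Matrix.smul_apply, Matrix.sum_apply, smul_eq_mul]
      split_ifs with h
      · rw [← Finset.mul_sum]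
      · simp)
  have h3 := vonNeumannEntropy_of_blocks φ3 (fun x => ∑ a, τ a x.1 x.2)
    (fun x => hτs _ _) (traceRight (traceLeft ρ)) (by
      rintro ⟨b, u, l⟩ ⟨b', v, l'⟩
      simp only [traceLeft, traceRight, Matrix.of_apply, hρ, φ3,
        Equiv.coe_fn_mk, Prod.mk.injEq, true_and, and_true, Matrix.sum_apply]
      split_ifs with h
      · rw [Finset.sum_comm]
        refine Finset.sum_congr rfl fun a _ => ?_
        rw [← Finset.sum_mul]
        exact congr_fun (congr_fun (hq1 a b l) u) v
      · simp)
  rw [condMutualInfo, h1, h2, h3, h4]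
  -- The alternative in `hq` is harmless: where the weights are not normalized, the blocks are zero
  -- and carry no entropy.
  have f1 : ∀ a b l, (∑ c, q l c) * (cfc Real.negMulLog (τ a b l)).trace.re =
      (cfc Real.negMulLog (τ a b l)).trace.re := by
    intro a b l
    rcases hq l with h | h
    · rw [h, one_mul]
    · rw [h, trace_cfc_negMulLog_zero, mul_zero]
  have f2 : ∀ b l, (∑ c, q l c) * (cfc Real.negMulLog (∑ a, τ a b l)).trace.re =
      (cfc Real.negMulLog (∑ a, τ a b l)).trace.re := by
    intro b l
    rcases hq l with h | h
    · rw [h, one_mul]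
    · simp only [h, Finset.sum_const_zero]
      rw [trace_cfc_negMulLog_zero, mul_zero]
  simp only [Fintype.sum_prod_type, trace_cfc_negMulLog_smul (hτ _ _ _),
    trace_cfc_negMulLog_smul (hτs _ _), Finset.sum_add_distrib, ← Finset.sum_mul, f1, f2,
    ← Finset.mul_sum, Matrix.trace_sum, Complex.re_sum]
  rw [← add_div, ← sub_div, ← sub_div]
  -- Adjoining `C` to `A B`, or to `B` alone, adds the same average entropy of `q l`, so the four
  -- terms cancel.
  have f3 : ∑ a, ∑ b, ∑ l, (τ a b l).trace.re * ∑ c, Real.negMulLog (q l c) =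
      ∑ b, ∑ l, (∑ a, (τ a b l).trace.re) * ∑ c, Real.negMulLog (q l c) := by
    rw [Finset.sum_comm]
    refine Finset.sum_congr rfl fun b _ => ?_
    rw [Finset.sum_comm]
    simp only [Finset.sum_mul]
  rw [f3]
  ring

end MarkovChain

/-! ### Weak dependence of the announcements and commutation -/

section WeakDependence

variable {S P a : Type*} [Fintype S] [Fintype P] [Fintype a] [DecidableEq a]
  {M : S → P → Matrix a a ℂ}

theorem toEuclideanLin_mul_apply (A B : Matrix a a ℂ) (v : EuclideanSpace ℂ a) :
    Matrix.toEuclideanLin (A * B) v = Matrix.toEuclideanLin A (Matrix.toEuclideanLin B v) := by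
  simp [Matrix.toLpLin_apply, Matrix.mulVec_mulVec]

theorem announcement_posSemidef (hM : IsPOVM M) (p : P) : (announcement M p).PosSemidef :=
  Matrix.posSemidef_sum _ fun s _ => hM.1 s p

theorem sum_announcement (hM : IsPOVM M) : ∑ p, announcement M p = 1 := by
  rw [← hM.2, Finset.sum_comm]
  rfl

theorem one_sub_announcement_posSemidef (hM : IsPOVM M) (p : P) :
    (1 - announcement M p).PosSemidef := by
  classical
  rw [← sum_announcement hM, ← Finset.add_sum_erase _ _ (Finset.mem_univ p), add_sub_cancel_left]
  exact Matrix.posSemidef_sum _ fun p _ => announcement_posSemidef hM p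

/-- On each block both products equal the scalar of `M_{p'}` times `M_sp`, since `M_sp` does not
leave the block; the blocks span. -/
theorem WeaklyDependent.announcementsCommute (h : WeaklyDependent M) : AnnouncementsCommute M := by
  obtain ⟨V, h1, h2⟩ := h
  intro s p p'
  obtain ⟨m, -, hm⟩ := h2 p'
  apply Matrix.toEuclideanLin.injective
  have hle : (⊤ : Submodule ℂ (EuclideanSpace ℂ a)) ≤
      LinearMap.eqLocus (Matrix.toEuclideanLin (M s p * announcement M p'))
        (Matrix.toEuclideanLin (announcement M p' * M s p)) := by
    rw [← V.complete]
    refine iSup_le fun l v hv => ?_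
    rw [LinearMap.mem_eqLocus, toEuclideanLin_mul_apply, toEuclideanLin_mul_apply, hm l v hv,
      hm l _ (h1 s p l v hv), map_smul]
  exact LinearMap.ext fun v => hle Submodule.mem_top

/-- The blocks are the nonzero joint eigenspaces of the `M_p`, which commute with one another by
summing (B) over `s`. -/
theorem AnnouncementsCommute.weaklyDependent (hM : IsPOVM M) (h : AnnouncementsCommute M) :
    WeaklyDependent M := by
  classical
  let T : P → EuclideanSpace ℂ a →ₗ[ℂ] EuclideanSpace ℂ a :=
    fun p => Matrix.toEuclideanLin (announcement M p)
  have hsym : ∀ p, (T p).IsSymmetric := fun p =>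
    Matrix.isSymmetric_toEuclideanLin_iff.2 (announcement_posSemidef hM p).1
  have hcommM : ∀ p p', announcement M p * announcement M p' =
      announcement M p' * announcement M p := by
    intro p p'
    have : announcement M p = ∑ s, M s p := rfl
    rw [this, Finset.sum_mul, Finset.mul_sum]
    exact Finset.sum_congr rfl fun s _ => h s p p'
  have hcomm : Pairwise (Function.onFun Commute T) := by
    intro p p' _
    refine LinearMap.ext fun v => ?_
    simp only [Module.End.mul_apply, T, ← toEuclideanLin_mul_apply, hcommM p p']
  let W : (P → ℂ) → Submodule ℂ (EuclideanSpace ℂ a) :=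
    fun χ => ⨅ p, Module.End.eigenspace (T p) (χ p)
  have hWtop : ⨆ χ, W χ = ⊤ := LinearMap.IsSymmetric.iSup_iInf_eq_top_of_commute hsym hcomm
  have hWorth := LinearMap.IsSymmetric.orthogonalFamily_iInf_eigenspaces hsym
  -- A nonzero joint eigenspace has an eigenvalue of `M_p` in each coordinate, so `χ` lies in a
  -- finite product of finite spectra.
  have hfin : {χ | W χ ≠ ⊥}.Finite := by
    have : {χ | W χ ≠ ⊥} ⊆ Set.pi Set.univ fun p => {μ | Module.End.HasEigenvalue (T p) μ} := by
      intro χ hχ p _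
      rw [Set.mem_ofPred_eq, Module.End.hasEigenvalue_iff]
      intro h0
      exact hχ (eq_bot_iff.2 ((iInf_le _ p).trans h0.le))
    refine Set.Finite.subset (Set.Finite.pi fun p => ?_) this
    exact Module.End.finite_hasEigenvalue (T p)
  have := hfin.fintype
  let ι := {χ | W χ ≠ ⊥}
  let eq := (Fintype.equivFin ι).symm
  have hmem : ∀ (χ : P → ℂ) (v : EuclideanSpace ℂ a), v ∈ W χ ↔
      ∀ p, Matrix.toEuclideanLin (announcement M p) v = χ p • v := by
    intro χ v
    simp only [W, Submodule.mem_iInf, Module.End.mem_eigenspace_iff]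
    rfl
  -- The eigenvalues are real and in `[0,1]` because `0 ≤ M_p ≤ 1`, tested on a joint eigenvector.
  have hev : ∀ p l, (0 ≤ ((eq l).1 p).re ∧ ((eq l).1 p).re ≤ 1) ∧
      ((((eq l).1 p).re : ℝ) : ℂ) = (eq l).1 p := by
    intro p l
    obtain ⟨w, hw, hw0⟩ := (Submodule.ne_bot_iff _).1 (eq l).2
    have hw' := (hmem _ _).1 hw p
    have hquad : ∀ A : Matrix a a ℂ, A.PosSemidef →
        0 ≤ inner ℂ w (Matrix.toEuclideanLin A w) := fun A hA => by
      have := hA.dotProduct_mulVec_nonneg (WithLp.ofLp w)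
      rw [EuclideanSpace.inner_eq_star_dotProduct, dotProduct_comm]
      exact this
    have h1 := hquad _ (announcement_posSemidef hM p)
    have h2 := hquad _ (one_sub_announcement_posSemidef hM p)
    have hone : Matrix.toEuclideanLin (1 : Matrix a a ℂ) w = w := by simp
    rw [map_sub, LinearMap.sub_apply, inner_sub_right, hone] at h2
    rw [hw', inner_smul_right, inner_self_eq_norm_sq_to_K] at h1 h2
    have hww : (0 : ℝ) < ‖w‖ ^ 2 := by positivity
    have hcast : ((‖w‖ : ℂ)) ^ 2 = ((‖w‖ ^ 2 : ℝ) : ℂ) := by push_cast; rfl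
    have h3 := Complex.le_def.1 h1
    have h4 := Complex.le_def.1 h2
    simp only [Complex.coe_algebraMap, hcast, Complex.sub_re, Complex.re_mul_ofReal,
      Complex.im_mul_ofReal, Complex.zero_re, Complex.zero_im, Complex.ofReal_re] at h3 h4
    refine ⟨⟨nonneg_of_mul_nonneg_left h3.1 hww, ?_⟩, ?_⟩
    · nlinarith [h4.1]
    · have := (mul_eq_zero.1 h3.2.symm).resolve_right hww.ne'
      exact Complex.ext rfl this.symm
  refine ⟨⟨Fintype.card ι, fun l => W (eq l).1, ?_, ?_⟩, ?_, ?_⟩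
  · intro l l' hl
    exact hWorth.isOrtho fun h => hl (eq.injective (Subtype.ext h))
  · rw [eq_top_iff, ← hWtop]
    refine iSup_le fun χ => ?_
    by_cases hχ : W χ = ⊥
    · simp [hχ]
    · refine le_trans ?_ (le_iSup _ (eq.symm ⟨χ, hχ⟩))
      simp
  · intro s p l v hv
    rw [hmem] at hv ⊢
    intro p'
    rw [← toEuclideanLin_mul_apply, ← h s p p', toEuclideanLin_mul_apply, hv p', map_smul]
  · intro p
    refine ⟨fun l => ((eq l).1 p).re, fun l => ?_, fun l v hv => ?_⟩
    · exact (hev p l).1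
    · rw [(hev p l).2]
      exact (hmem _ v).1 hv p

theorem weaklyDependent_iff_announcementsCommute (hM : IsPOVM M) :
    WeaklyDependent M ↔ AnnouncementsCommute M :=
  ⟨WeaklyDependent.announcementsCommute, AnnouncementsCommute.weaklyDependent hM⟩

end WeakDependence

/-! ### The projections onto the blocks -/

section BlockProjections

variable {S P a : Type*} [Fintype S] [Fintype P] [Fintype a] [DecidableEq a]
  {M : S → P → Matrix a a ℂ}

/-- The matrix of the orthogonal projection onto a block. -/
def BlockDecomposition.proj (V : BlockDecomposition a) (l : Fin V.num) : Matrix a a ℂ :=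
  Matrix.toEuclideanLin.symm
    ((V.space l).starProjection : EuclideanSpace ℂ a →ₗ[ℂ] EuclideanSpace ℂ a)

variable (V : BlockDecomposition a)

theorem BlockDecomposition.toEuclideanLin_proj (l : Fin V.num) (v : EuclideanSpace ℂ a) :
    Matrix.toEuclideanLin (V.proj l) v = (V.space l).starProjection v := by
  simp [BlockDecomposition.proj]

theorem BlockDecomposition.proj_conjTranspose (l : Fin V.num) : (V.proj l)ᴴ = V.proj l := by
  have : (V.proj l).IsHermitian := by
    rw [← Matrix.isSymmetric_toEuclideanLin_iff]
    simp only [BlockDecomposition.proj, LinearEquiv.apply_symm_apply]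
    exact Submodule.starProjection_isSymmetric _
  exact this

theorem BlockDecomposition.proj_mul_self (l : Fin V.num) : V.proj l * V.proj l = V.proj l := by
  apply Matrix.toEuclideanLin.injective
  refine LinearMap.ext fun v => ?_
  rw [toEuclideanLin_mul_apply]
  simp only [V.toEuclideanLin_proj]
  exact Submodule.starProjection_eq_self_iff.2 (Submodule.starProjection_apply_mem _ _)

theorem BlockDecomposition.sum_proj : ∑ l, V.proj l = 1 := by
  apply Matrix.toEuclideanLin.injective
  refine LinearMap.ext fun v => ?_
  have hO : OrthogonalFamily ℂ (fun l => V.space l) fun l => (V.space l).subtypeₗᵢ :=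
    OrthogonalFamily.of_pairwise fun l l' h => V.orthogonal l l' h
  have := hO.sum_projection_of_mem_iSup v (by rw [V.complete]; trivial)
  rw [map_sum, LinearMap.sum_apply]
  simp only [V.toEuclideanLin_proj]
  rw [this]
  simp

variable {V}

/-- All blocks are invariant and mutually orthogonal, so `P_{l'} M_sp P_l` is `M_sp P_l` for `l' =
l` and zero otherwise; then insert the resolution of the identity. -/
theorem WeaklyDependentAlong.proj_commute (h : WeaklyDependentAlong M V) (s : S) (p : P)
    (l : Fin V.num) : V.proj l * M s p = M s p * V.proj l := by
  have key : ∀ l l', V.proj l' * M s p * V.proj l = if l' = l then M s p * V.proj l else 0 := by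
    intro l l'
    apply Matrix.toEuclideanLin.injective
    refine LinearMap.ext fun v => ?_
    rw [Matrix.mul_assoc, toEuclideanLin_mul_apply, V.toEuclideanLin_proj]
    have hmem : Matrix.toEuclideanLin (M s p * V.proj l) v ∈ V.space l := by
      rw [toEuclideanLin_mul_apply, V.toEuclideanLin_proj]
      exact h.1 s p l _ (Submodule.starProjection_apply_mem _ _)
    split_ifs with hl
    · subst hl
      exact Submodule.starProjection_eq_self_iff.2 hmem
    · rw [map_zero, LinearMap.zero_apply, Submodule.starProjection_apply_eq_zero_iff]
      exact (V.orthogonal l l' (Ne.symm hl)) hmem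
  calc V.proj l * M s p = V.proj l * M s p * ∑ l', V.proj l' := by rw [V.sum_proj, Matrix.mul_one]
    _ = M s p * V.proj l := by simp [Matrix.mul_sum, key]

/-- Normalization of the scalars comes from `∑_p M_p = 1` on the block. A decomposition may contain
zero subspaces, whose scalars are arbitrary; hence the alternative. -/
theorem WeaklyDependentAlong.exists_announcement_mul_proj (hM : IsPOVM M)
    (h : WeaklyDependentAlong M V) : ∃ m : Fin V.num → P → ℝ,
      (∀ l p, announcement M p * V.proj l = (m l p : ℂ) • V.proj l) ∧
      ∀ l, ∑ p, m l p = 1 ∨ V.proj l = 0 := by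
  choose m _ hm using h.2
  have h1 : ∀ l p, announcement M p * V.proj l = (m p l : ℂ) • V.proj l := by
    intro l p
    apply Matrix.toEuclideanLin.injective
    refine LinearMap.ext fun v => ?_
    rw [toEuclideanLin_mul_apply, map_smul, LinearMap.smul_apply, V.toEuclideanLin_proj]
    exact hm p l _ (Submodule.starProjection_apply_mem _ _)
  refine ⟨fun l p => m p l, h1, fun l => ?_⟩
  have h2 : (∑ p, (m p l : ℂ)) • V.proj l = V.proj l := by
    rw [Finset.sum_smul]
    simp only [← h1]
    rw [← Finset.sum_mul, sum_announcement hM, Matrix.one_mul]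
  have h3 : ((∑ p, (m p l : ℂ)) - 1) • V.proj l = 0 := by rw [sub_smul, h2, one_smul, sub_self]
  rcases smul_eq_zero.1 h3 with h4 | h4
  · left
    exact_mod_cast sub_eq_zero.1 h4
  · right
    exact h4

end BlockProjections

/-! ### Tensor products of families of matrices and partial contractions -/

section PiMat

variable {ι : Type*} [Fintype ι] [DecidableEq ι] {d : ι → Type*}

/-- The tensor product of a family of matrices. -/
def piMat (N : ∀ i, Matrix (d i) (d i) ℂ) : Matrix (∀ i, d i) (∀ i, d i) ℂ :=
  Matrix.of fun a b => ∏ i, N i (a i) (b i)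

theorem piMat_apply (N : ∀ i, Matrix (d i) (d i) ℂ) (a b : ∀ i, d i) :
    piMat N a b = ∏ i, N i (a i) (b i) := rfl

theorem piMat_mul [∀ i, Fintype (d i)] (N N' : ∀ i, Matrix (d i) (d i) ℂ) :
    piMat N * piMat N' = piMat fun i => N i * N' i := by
  ext a b
  simp only [Matrix.mul_apply, piMat_apply, ← Finset.prod_mul_distrib]
  rw [Finset.prod_univ_sum, Fintype.piFinset_univ]

theorem piMat_one [∀ i, DecidableEq (d i)] : piMat (fun i => (1 : Matrix (d i) (d i) ℂ)) = 1 := by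
  ext a b
  rw [piMat_apply, Matrix.one_apply]
  split_ifs with h
  · subst h
    exact Finset.prod_eq_one fun i _ => Matrix.one_apply_eq _
  · obtain ⟨i, hi⟩ := Function.ne_iff.1 h
    exact Finset.prod_eq_zero (Finset.mem_univ i) (Matrix.one_apply_ne hi)

theorem piMat_conjTranspose (N : ∀ i, Matrix (d i) (d i) ℂ) :
    (piMat N)ᴴ = piMat fun i => (N i)ᴴ := by
  ext a b
  simp [piMat_apply, Matrix.conjTranspose_apply]

theorem piMat_posSemidef [∀ i, Fintype (d i)] [∀ i, DecidableEq (d i)]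
    {N : ∀ i, Matrix (d i) (d i) ℂ} (hN : ∀ i, (N i).PosSemidef) : (piMat N).PosSemidef := by
  have h : piMat N = (piMat fun i => psdPow (hN i) (1 / 2))ᴴ *
      piMat fun i => psdPow (hN i) (1 / 2) := by
    rw [piMat_conjTranspose, piMat_mul]
    simp only [psdPow_half_conjTranspose, psdPow_half_mul_half]
  rw [h]
  exact Matrix.posSemidef_conjTranspose_mul_self _

theorem piMat_sum {Y : ι → Type*} (F : ∀ i, Finset (Y i)) (N : ∀ i, Y i → Matrix (d i) (d i) ℂ) :
    piMat (fun i => ∑ y ∈ F i, N i y) =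
      ∑ y ∈ Fintype.piFinset F, piMat fun i => N i (y i) := by
  ext a b
  simp only [piMat_apply, Matrix.sum_apply]
  exact Finset.prod_univ_sum _ _

theorem piMat_update_smul (N : ∀ i, Matrix (d i) (d i) ℂ) (i : ι) (q : ℂ) :
    piMat (Function.update N i (q • N i)) = q • piMat N := by
  ext a b
  have h : ∀ j, Function.update N i (q • N i) j (a j) (b j) =
      (if j = i then q else 1) * N j (a j) (b j) := by
    intro j
    by_cases hj : j = i
    · subst hj
      simp
    · simp [hj]
  simp only [piMat_apply, Matrix.smul_apply, h, Finset.prod_mul_distrib, Finset.prod_ite_eq',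
    Finset.mem_univ, if_true, smul_eq_mul]

end PiMat

/-! ### Contracting a bipartite operator against an effect on its first factor -/

section Contraction

variable {A e L : Type*} [Fintype A]

/-- The operator `Tr_A[(N ⊗ 1) ρ]` on the second factor. -/
def contract (N : Matrix A A ℂ) (ρ : Matrix (A × e) (A × e) ℂ) : Matrix e e ℂ :=
  Matrix.of fun u v => ∑ a, ∑ a', N a' a * ρ (a, u) (a', v)

theorem contract_apply (N : Matrix A A ℂ) (ρ : Matrix (A × e) (A × e) ℂ) (u v : e) :
    contract N ρ u v = ∑ a, ∑ a', N a' a * ρ (a, u) (a', v) := rfl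

theorem contract_sum {κ : Type*} (s : Finset κ) (N : κ → Matrix A A ℂ)
    (ρ : Matrix (A × e) (A × e) ℂ) : contract (∑ k ∈ s, N k) ρ = ∑ k ∈ s, contract (N k) ρ := by
  ext u v
  simp only [contract_apply, Matrix.sum_apply, Finset.sum_mul]
  rw [Finset.sum_comm (s := s)]
  exact Finset.sum_congr rfl fun a _ => Finset.sum_comm

theorem contract_smul (q : ℂ) (N : Matrix A A ℂ) (ρ : Matrix (A × e) (A × e) ℂ) :
    contract (q • N) ρ = q • contract N ρ := by
  ext u v
  simp only [contract_apply, Matrix.smul_apply, smul_eq_mul, Finset.mul_sum, mul_assoc]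

theorem contract_one [DecidableEq A] (ρ : Matrix (A × e) (A × e) ℂ) :
    contract 1 ρ = traceLeft ρ := by
  ext u v
  simp [contract_apply, traceLeft, Matrix.one_apply]

theorem traceLeft_posSemidef [Finite e] {ρ : Matrix (A × e) (A × e) ℂ} (hρ : ρ.PosSemidef) :
    (traceLeft ρ).PosSemidef := by
  have : traceLeft ρ = ∑ a, ρ.submatrix (fun u => (a, u)) fun u => (a, u) := by
    ext u v
    simp [traceLeft, Matrix.sum_apply]
  rw [this]
  exact Matrix.posSemidef_sum _ fun a _ => hρ.submatrix _

theorem trace_traceLeft [Fintype e] (ρ : Matrix (A × e) (A × e) ℂ) :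
    (traceLeft ρ).trace = ρ.trace := by
  simp only [traceLeft, Matrix.trace, Matrix.diag_apply, Matrix.of_apply, Fintype.sum_prod_type]
  exact Finset.sum_comm

theorem trace_traceRight [Fintype e] (ρ : Matrix (A × e) (A × e) ℂ) :
    (traceRight ρ).trace = ρ.trace := by
  simp only [traceRight, Matrix.trace, Matrix.diag_apply, Matrix.of_apply, Fintype.sum_prod_type]

theorem contract_classical [DecidableEq L] (N : Matrix A A ℂ)
    (σ : L → Matrix (A × e) (A × e) ℂ) (ν : Matrix (A × e × L) (A × e × L) ℂ)
    (hν : ∀ u v, ν u v = if u.2.2 = v.2.2 then σ u.2.2 (u.1, u.2.1) (v.1, v.2.1) else 0)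
    (u v : e × L) : contract N ν u v = if u.2 = v.2 then contract N (σ u.2) u.1 v.1 else 0 := by
  simp only [contract_apply, hν]
  split_ifs with h <;> simp

variable [Fintype e] [DecidableEq e]

theorem kronecker_one_mul_apply (P : Matrix A A ℂ) (ρ : Matrix (A × e) (A × e) ℂ) (a : A) (u : e)
    (x : A × e) : ((P ⊗ₖ (1 : Matrix e e ℂ)) * ρ) (a, u) x = ∑ b, P a b * ρ (b, u) x := by
  simp [Matrix.mul_apply, Fintype.sum_prod_type, Matrix.kroneckerMap_apply, Matrix.one_apply]

theorem mul_kronecker_one_apply (P : Matrix A A ℂ) (ρ : Matrix (A × e) (A × e) ℂ) (a : A) (u : e)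
    (x : A × e) : (ρ * (P ⊗ₖ (1 : Matrix e e ℂ))) x (a, u) = ∑ b, ρ x (b, u) * P b a := by
  simp [Matrix.mul_apply, Fintype.sum_prod_type, Matrix.kroneckerMap_apply, Matrix.one_apply]

theorem contract_kronecker_one_mul (N P : Matrix A A ℂ) (ρ : Matrix (A × e) (A × e) ℂ) :
    contract N ((P ⊗ₖ (1 : Matrix e e ℂ)) * ρ) = contract (N * P) ρ := by
  ext u v
  simp only [contract_apply, kronecker_one_mul_apply]
  simp only [Matrix.mul_apply, Finset.mul_sum, Finset.sum_mul]
  rw [Finset.sum_comm]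
  conv_rhs => rw [Finset.sum_comm]
  refine Finset.sum_congr rfl fun a' _ => ?_
  rw [Finset.sum_comm]
  exact Finset.sum_congr rfl fun b _ => Finset.sum_congr rfl fun a _ => by ring

/-- Cyclicity of the partial trace for operators on the traced factor, which moves `Q` to the left
of `N`. -/
theorem contract_mul_kronecker_one (N Q : Matrix A A ℂ) (ρ : Matrix (A × e) (A × e) ℂ) :
    contract N (ρ * (Q ⊗ₖ (1 : Matrix e e ℂ))) = contract (Q * N) ρ := by
  ext u v
  simp only [contract_apply, mul_kronecker_one_apply]
  simp only [Matrix.mul_apply, Finset.mul_sum, Finset.sum_mul]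
  refine Finset.sum_congr rfl fun a _ => ?_
  rw [Finset.sum_comm]
  exact Finset.sum_congr rfl fun b _ => Finset.sum_congr rfl fun a' _ => by ring

theorem contract_posSemidef [DecidableEq A] {N : Matrix A A ℂ} {ρ : Matrix (A × e) (A × e) ℂ}
    (hN : N.PosSemidef) (hρ : ρ.PosSemidef) : (contract N ρ).PosSemidef := by
  have h : contract N ρ = traceLeft ((psdPow hN (1 / 2) ⊗ₖ (1 : Matrix e e ℂ)) * ρ *
      (psdPow hN (1 / 2) ⊗ₖ (1 : Matrix e e ℂ))ᴴ) := by
    rw [Matrix.conjTranspose_kronecker, Matrix.conjTranspose_one, psdPow_half_conjTranspose,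
      ← contract_one, contract_mul_kronecker_one, contract_kronecker_one_mul, Matrix.mul_one,
      psdPow_half_mul_half]
  rw [h]
  exact traceLeft_posSemidef (hρ.mul_mul_conjTranspose_same _)

end Contraction

theorem diagonal_single_posSemidef {κ : Type*} [DecidableEq κ] (k : κ) :
    (Matrix.diagonal (Pi.single k (1 : ℂ))).PosSemidef := by
  refine Matrix.PosSemidef.diagonal fun k' => ?_
  by_cases hk : k' = k
  · subst hk
    simp
  · simp [hk]

/-! ### The block-diagonal attack -/

section Attack

variable {n : ℕ} {d : Fin n → Type*} [∀ i, Fintype (d i)] [∀ i, DecidableEq (d i)]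
  {e : Type*} [Fintype e] [DecidableEq e] (V : ∀ i, BlockDecomposition (d i))

/-- The projection onto `⨂ V_i^{l_i}`. -/
def blockProj (l : Labels V) : Matrix (∀ i, d i) (∀ i, d i) ℂ := piMat fun i => (V i).proj (l i)

/-- The component of `ρ` in the block `l`. -/
def blockComponent (ρ : Matrix ((∀ i, d i) × e) ((∀ i, d i) × e) ℂ) (l : Labels V) :
    Matrix ((∀ i, d i) × e) ((∀ i, d i) × e) ℂ :=
  (blockProj V l ⊗ₖ (1 : Matrix e e ℂ)) * ρ * (blockProj V l ⊗ₖ (1 : Matrix e e ℂ))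

/-- The attack in which the block labels are measured and stored. -/
def blockAttack (ρ : Matrix ((∀ i, d i) × e) ((∀ i, d i) × e) ℂ) :
    Matrix ((∀ i, d i) × e × Labels V) ((∀ i, d i) × e × Labels V) ℂ :=
  Matrix.of fun u v =>
    if u.2.2 = v.2.2 then blockComponent V ρ u.2.2 (u.1, u.2.1) (v.1, v.2.1) else 0

theorem blockProj_conjTranspose (l : Labels V) : (blockProj V l)ᴴ = blockProj V l := by
  simp only [blockProj, piMat_conjTranspose, BlockDecomposition.proj_conjTranspose]

theorem blockComponent_posSemidef {ρ : Matrix ((∀ i, d i) × e) ((∀ i, d i) × e) ℂ}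
    (hρ : ρ.PosSemidef) (l : Labels V) : (blockComponent V ρ l).PosSemidef := by
  have := hρ.mul_mul_conjTranspose_same (blockProj V l ⊗ₖ (1 : Matrix e e ℂ))
  rwa [Matrix.conjTranspose_kronecker, Matrix.conjTranspose_one, blockProj_conjTranspose] at this

theorem blockAttack_posSemidef {ρ : Matrix ((∀ i, d i) × e) ((∀ i, d i) × e) ℂ}
    (hρ : ρ.PosSemidef) : (blockAttack V ρ).PosSemidef := by
  have h : blockAttack V ρ = ∑ l, (blockComponent V ρ l ⊗ₖ
      Matrix.diagonal (Pi.single l (1 : ℂ))).submatrix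
        (fun u : (∀ i, d i) × e × Labels V => ((u.1, u.2.1), u.2.2))
        (fun u : (∀ i, d i) × e × Labels V => ((u.1, u.2.1), u.2.2)) := by
    ext ⟨a, u, l⟩ ⟨b, v, l'⟩
    by_cases h : l = l' <;>
      simp [blockAttack, Matrix.sum_apply, Matrix.kroneckerMap_apply, h, Pi.single_apply]
  rw [h]
  refine Matrix.posSemidef_sum _ fun l _ => Matrix.PosSemidef.submatrix ?_ _
  exact (blockComponent_posSemidef V hρ l).kronecker (diagonal_single_posSemidef l)

theorem contract_blockComponent (N : ∀ i, Matrix (d i) (d i) ℂ)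
    (ρ : Matrix ((∀ i, d i) × e) ((∀ i, d i) × e) ℂ) (l : Labels V) :
    contract (piMat N) (blockComponent V ρ l) =
      contract (piMat fun i => (V i).proj (l i) * N i * (V i).proj (l i)) ρ := by
  rw [blockComponent, contract_mul_kronecker_one, contract_kronecker_one_mul, blockProj,
    piMat_mul, piMat_mul]

/-- Summing over labels replaces the effect `N` by its pinching `∑_l P_l N P_l`, which is `N` itself
by commutation. Hence the label measurement is invisible to the protocol and to Eve's original
system. -/
theorem traceRight_contract_blockAttack (N : ∀ i, Matrix (d i) (d i) ℂ)
    (hN : ∀ i l, (V i).proj l * N i = N i * (V i).proj l)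
    (ρ : Matrix ((∀ i, d i) × e) ((∀ i, d i) × e) ℂ) :
    traceRight (contract (piMat N) (blockAttack V ρ)) = contract (piMat N) ρ := by
  have h1 : traceRight (contract (piMat N) (blockAttack V ρ)) =
      ∑ l, contract (piMat N) (blockComponent V ρ l) := by
    ext u v
    simp only [traceRight, Matrix.of_apply, Matrix.sum_apply,
      contract_classical (piMat N) (blockComponent V ρ) (blockAttack V ρ) (fun _ _ => rfl), if_true]
  have h2 : ∀ i l, (V i).proj l * N i * (V i).proj l = N i * (V i).proj l := fun i l => by
    rw [hN, Matrix.mul_assoc, (V i).proj_mul_self]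
  simp only [h1, contract_blockComponent, h2]
  rw [← contract_sum]
  congr 1
  have h3 := piMat_sum (fun i => (Finset.univ : Finset (Fin (V i).num)))
    fun i l => N i * (V i).proj l
  rw [Fintype.piFinset_univ] at h3
  rw [← h3]
  simp only [← Matrix.mul_sum, (V _).sum_proj, Matrix.mul_one]

theorem blockAttack_isState {ρ : Matrix ((∀ i, d i) × e) ((∀ i, d i) × e) ℂ} (hρ : IsState ρ) :
    IsState (blockAttack V ρ) := by
  refine ⟨blockAttack_posSemidef V hρ.1, ?_⟩
  -- The trivial effect commutes with every projection, which gives preservation of the trace.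
  have := traceRight_contract_blockAttack V (fun i => (1 : Matrix (d i) (d i) ℂ))
    (fun i l => by rw [Matrix.mul_one, Matrix.one_mul]) ρ
  rw [piMat_one, contract_one, contract_one] at this
  rw [← trace_traceLeft, ← trace_traceRight, this, trace_traceLeft, hρ.2]

/-- The columns of the tensor product of projections are product vectors with factors in the blocks.
-/
theorem toEuclideanLin_blockProj_mem (l : Labels V) (w : EuclideanSpace ℂ (∀ i, d i)) :
    Matrix.toEuclideanLin (blockProj V l) w ∈ tensorSubspace fun i => (V i).space (l i) := by
  have h : Matrix.toEuclideanLin (blockProj V l) w =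
      ∑ a, w a • WithLp.toLp 2 fun x => blockProj V l x a := by
    ext x
    simp [Matrix.toLpLin_apply, Matrix.mulVec, dotProduct, mul_comm]
  rw [h]
  refine Submodule.sum_mem _ fun a _ => Submodule.smul_mem _ _ (Submodule.subset_span ?_)
  refine ⟨fun i => Matrix.toEuclideanLin ((V i).proj (l i)) (EuclideanSpace.single (a i) 1),
    fun i => ?_, fun x => ?_⟩
  · beta_reduce
    rw [(V i).toEuclideanLin_proj]
    exact Submodule.starProjection_apply_mem _ _
  · simp [blockProj, piMat_apply, Matrix.toLpLin_apply]

theorem blockAttack_isBlockDiagonalAttack {ρ : Matrix ((∀ i, d i) × e) ((∀ i, d i) × e) ℂ}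
    (hρ : ρ.PosSemidef) : IsBlockDiagonalAttack V (blockAttack V ρ) := by
  refine ⟨blockComponent V ρ, blockComponent_posSemidef V hρ, fun _ _ => rfl, fun l w => ?_⟩
  -- The left projection acts only on the `Q` systems and so comes out of the trace over `E`; this
  -- alone places the range in the block.
  have h : traceRight (blockComponent V ρ l) = blockProj V l *
      traceRight (ρ * (blockProj V l ⊗ₖ (1 : Matrix e e ℂ))) := by
    ext a b
    simp only [blockComponent, Matrix.mul_assoc, traceRight, Matrix.of_apply,
      kronecker_one_mul_apply, Matrix.mul_apply (M := blockProj V l), Finset.mul_sum]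
    exact Finset.sum_comm
  rw [h, toEuclideanLin_mul_apply]
  exact toEuclideanLin_blockProj_mem V l _

end Attack

/-! ### The output states of the protocol -/

section Output

variable {n : ℕ} {S P X : Type*} [DecidableEq X] {d : Fin n → Type*} {e : Type*}
  (M : ∀ i, S → P → Matrix (d i) (d i) ℂ) (t : Fin n → S → P → X)

/-- The POVM of round `i` with outcomes `(s, p, x)`. -/
def outcomePOVM (i : Fin n) (y : S × P × X) : Matrix (d i) (d i) ℂ :=
  if y.2.2 = t i y.1 y.2.1 then M i y.1 y.2.1 else 0

theorem outputState_eq_contract [∀ i, Fintype (d i)]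
    (ρ : Matrix ((∀ i, d i) × e) ((∀ i, d i) × e) ℂ) (y : Fin n → S × P × X) :
    outputState M t ρ y = contract (piMat fun i => outcomePOVM M t i (y i)) ρ := by
  ext u v
  simp only [outputState, Matrix.of_apply, contract_apply, piMat_apply, outcomePOVM]
  split_ifs with h
  · simp [h]
  · push Not at h
    obtain ⟨i, hi⟩ := h
    refine (Finset.sum_eq_zero fun a _ => Finset.sum_eq_zero fun a' _ => ?_).symm
    rw [Finset.prod_eq_zero (Finset.mem_univ i) (by simp [hi]), zero_mul]

variable [∀ i, Fintype (d i)] [∀ i, DecidableEq (d i)] [Fintype S] [Fintype P]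
variable {M}

theorem outcomePOVM_posSemidef (hM : ∀ i, IsPOVM (M i)) (i : Fin n) (y : S × P × X) :
    (outcomePOVM M t i y).PosSemidef := by
  unfold outcomePOVM
  split_ifs
  · exact (hM i).1 _ _
  · exact Matrix.PosSemidef.zero

theorem outputState_posSemidef [Fintype e] [DecidableEq e] (hM : ∀ i, IsPOVM (M i))
    {ρ : Matrix ((∀ i, d i) × e) ((∀ i, d i) × e) ℂ} (hρ : ρ.PosSemidef)
    (y : Fin n → S × P × X) : (outputState M t ρ y).PosSemidef := by
  rw [outputState_eq_contract]
  exact contract_posSemidef (piMat_posSemidef fun i => outcomePOVM_posSemidef t hM i _) hρ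

theorem traceRight_outputState_blockAttack [Fintype e] [DecidableEq e]
    {V : ∀ i, BlockDecomposition (d i)} (hV : ∀ i, WeaklyDependentAlong (M i) (V i))
    (ρ : Matrix ((∀ i, d i) × e) ((∀ i, d i) × e) ℂ) (y : Fin n → S × P × X) :
    traceRight (outputState M t (blockAttack V ρ) y) = outputState M t ρ y := by
  rw [outputState_eq_contract, outputState_eq_contract]
  refine traceRight_contract_blockAttack V _ (fun i l => ?_) ρ
  unfold outcomePOVM
  split_ifs
  · exact (hV i).proj_commute _ _ l
  · simp

theorem sum_outcomePOVM [Fintype X] (hM : ∀ i, IsPOVM (M i)) (i : Fin n) :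
    ∑ y, outcomePOVM M t i y = 1 := by
  rw [← (hM i).2]
  simp [outcomePOVM, Fintype.sum_prod_type]

theorem sum_outcomePOVM_announcement [Fintype X] [DecidableEq P] (i : Fin n) (c : P) :
    ∑ y : S × P × X with y.2.1 = c, outcomePOVM M t i y = announcement (M i) c := by
  rw [Finset.sum_filter]
  simp only [outcomePOVM, Fintype.sum_prod_type, announcement]
  refine Finset.sum_congr rfl fun s _ => ?_
  rw [Finset.sum_eq_single c]
  · simp
  · intro p _ hp
    simp [hp]
  · simp

variable [DecidableEq S] [DecidableEq P] [Fintype X]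

/-- The effect of the past outcomes: in the rounds before `i` the outcomes are `s` and `p`, and the
other rounds are ignored. -/
def pastEffect (i : Fin n) (s : Fin i → S) (p : Fin i → P) (j : Fin n) : Matrix (d j) (d j) ℂ :=
  ∑ y : S × P × X with ∀ h : (j : ℕ) < i, y.1 = s ⟨j, h⟩ ∧ y.2.1 = p ⟨j, h⟩, outcomePOVM M t j y

theorem pastEffect_posSemidef (hM : ∀ i, IsPOVM (M i)) (i : Fin n) (s : Fin i → S)
    (p : Fin i → P) (j : Fin n) : (pastEffect (M := M) t i s p j).PosSemidef :=
  Matrix.posSemidef_sum _ fun y _ => outcomePOVM_posSemidef t hM j y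

theorem pastEffect_self (hM : ∀ i, IsPOVM (M i)) (i : Fin n) (s : Fin i → S) (p : Fin i → P) :
    pastEffect (M := M) t i s p i = 1 := by
  rw [← sum_outcomePOVM t hM i, pastEffect]
  congr 1
  ext y
  simp

/-- The constraints defining the marginal are imposed round by round, so the sum of product effects
is a product of sums: fixed outcomes before `i`, the announcement effect at `i`, no constraint
after. -/
theorem classicalMarginal_outputState (i : Fin n) (s : Fin i → S) (p : Fin i → P) (c : P)
    (ρ : Matrix ((∀ i, d i) × e) ((∀ i, d i) × e) ℂ) :
    classicalMarginal (fun y : Fin n → S × P × X =>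
          (fun j : Fin i => (y (j.castLE i.isLt.le)).1,
            fun j : Fin i => (y (j.castLE i.isLt.le)).2.1, (y i).2.1))
        (outputState M t ρ) (s, p, c) =
      contract
        (piMat (Function.update (pastEffect (M := M) t i s p) i (announcement (M i) c))) ρ := by
  let F : Fin n → Finset (S × P × X) := fun j =>
    Finset.univ.filter fun y => (∀ h : (j : ℕ) < i, y.1 = s ⟨j, h⟩ ∧ y.2.1 = p ⟨j, h⟩) ∧
      (j = i → y.2.1 = c)
  have h1 : Function.update (pastEffect (M := M) t i s p) i (announcement (M i) c) =
      fun j => ∑ y ∈ F j, outcomePOVM M t j y := by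
    funext j
    by_cases hj : j = i
    · subst hj
      rw [Function.update_self, ← sum_outcomePOVM_announcement t]
      congr 1
      ext y
      simp [F]
    · rw [Function.update_of_ne hj, pastEffect]
      congr 1
      ext y
      simp [F, hj]
  rw [h1, piMat_sum, contract_sum]
  simp only [classicalMarginal, outputState_eq_contract]
  congr 1
  ext y
  simp only [Finset.mem_filter, Finset.mem_univ, true_and, Fintype.mem_piFinset, F, Prod.mk.injEq,
    funext_iff]
  constructor
  · rintro ⟨h1, h2, h3⟩ j
    exact ⟨fun h => ⟨h1 ⟨j, h⟩, h2 ⟨j, h⟩⟩, fun h => h ▸ h3⟩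
  · intro h
    exact ⟨fun j => ((h (j.castLE i.isLt.le)).1 j.isLt).1,
      fun j => ((h (j.castLE i.isLt.le)).1 j.isLt).2, (h i).2 rfl⟩

/-- Within a block, the effect of announcing `c` in round `i` is the scalar `m (l i) c`, whatever
the past outcomes and Eve's state. -/
theorem markovConditions_outputState_blockAttack [Fintype e] [DecidableEq e]
    (hM : ∀ i, IsPOVM (M i)) {V : ∀ i, BlockDecomposition (d i)}
    (hV : ∀ i, WeaklyDependentAlong (M i) (V i))
    {ρ : Matrix ((∀ i, d i) × e) ((∀ i, d i) × e) ℂ} (hρ : ρ.PosSemidef) :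
    MarkovConditions (outputState M t (blockAttack V ρ)) := by
  intro i
  obtain ⟨m, hm, hm1⟩ := (hV i).exists_announcement_mul_proj (hM i)
  refine condMutualInfo_eq_zero_of_conditionally_independent (fun l c => m (l i) c)
    (fun s p l => contract (piMat (pastEffect (M := M) t i s p)) (blockComponent V ρ l))
    (fun s p l => (contract_posSemidef
      (piMat_posSemidef fun j => pastEffect_posSemidef t hM i s p j)
      (blockComponent_posSemidef V hρ l)).1) (fun l => ?_) _ ?_
  -- If the block of round `i` is the zero subspace, the whole component with label `l` vanishes.
  · refine (hm1 (l i)).imp id fun h0 s p => ?_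
    have : blockProj V l = 0 := by
      ext a b
      rw [blockProj, piMat_apply, Finset.prod_eq_zero (Finset.mem_univ i) (by simp [h0])]
      rfl
    rw [blockComponent, this]
    ext u v
    simp [contract_apply]
  · intro s p u l c s' p' v l' c'
    simp only [pastAndAnnouncement, Matrix.of_apply, classicalMarginal_outputState]
    rw [contract_classical _ (blockComponent V ρ) (blockAttack V ρ) (fun _ _ => rfl)]
    -- In factor `i` the past effect is the identity, so `P M_c P = m P` is just `m` times the
    -- factor already there.
    have key : contract (piMat (Function.update (pastEffect (M := M) t i s p) i
        (announcement (M i) c))) (blockComponent V ρ l) =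
        (m (l i) c : ℂ) • contract (piMat (pastEffect (M := M) t i s p))
          (blockComponent V ρ l) := by
      rw [contract_blockComponent, contract_blockComponent, ← contract_smul,
        ← piMat_update_smul _ i]
      congr 2
      funext j
      by_cases hj : j = i
      · subst hj
        rw [Function.update_self, Function.update_self, pastEffect_self t hM, Matrix.mul_one,
          Matrix.mul_assoc, hm, Matrix.mul_smul]
      · rw [Function.update_of_ne hj, Function.update_of_ne hj]
    rw [key]
    by_cases h1 : s = s' ∧ p = p' ∧ c = c'
    · by_cases h2 : l = l'
      · rw [if_pos h1, if_pos h2, if_pos ⟨h1.1, h1.2.1, h2, h1.2.2⟩]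
        rfl
      · rw [if_pos h1, if_neg h2, if_neg (fun h => h2 h.2.2.1)]
    · rw [if_neg h1, if_neg (fun h => h1 ⟨h.1, h.2.1, h.2.2.2⟩)]

end Output

/-! ### Discarding a register of the adversary -/

section Discard

variable {n : ℕ} {S P X : Type*} [Fintype S] [DecidableEq S] [Fintype P] [DecidableEq P]
  [Fintype X] [DecidableEq X] {e L : Type*} [Fintype e] [DecidableEq e] [Fintype L] [DecidableEq L]

theorem eventProb_traceRight (ω : (Fin n → S × P × X) → Matrix (e × L) (e × L) ℂ)
    (Ω : Finset (Fin n → X)) : eventProb (fun y => traceRight (ω y)) Ω = eventProb ω Ω := by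
  simp only [eventProb, trace_traceRight]

/-- Discarding the labels changes neither the classical outcomes nor the normalization, so it
commutes with conditioning. -/
theorem conditioned_traceRight (ω : (Fin n → S × P × X) → Matrix (e × L) (e × L) ℂ)
    (Ω : Finset (Fin n → X)) :
    conditioned (fun y => traceRight (ω y)) Ω = fun y => traceRight (conditioned ω Ω y) := by
  funext y
  ext u v
  rw [conditioned, eventProb_traceRight]
  simp only [conditioned]
  split_ifs with h <;> simp [traceRight, Finset.mul_sum]

theorem conditioned_posSemidef {ω : (Fin n → S × P × X) → Matrix e e ℂ}
    (hω : ∀ y, (ω y).PosSemidef) (Ω : Finset (Fin n → X)) (y : Fin n → S × P × X) :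
    (conditioned ω Ω y).PosSemidef := by
  unfold conditioned
  split_ifs
  · refine (hω y).smul ?_
    have : 0 ≤ eventProb ω Ω :=
      Finset.sum_nonneg fun y _ => posSemidef_trace_re_nonneg (hω y)
    rw [← Complex.ofReal_inv]
    exact_mod_cast inv_nonneg.2 this
  · exact Matrix.PosSemidef.zero

theorem secretPublic_apply (ω : (Fin n → S × P × X) → Matrix e e ℂ)
    (s s' : Fin n → S) (p p' : Fin n → P) (u v : e) :
    secretPublic ω (s, p, u) (s', p', v) = ∑ y : Fin n → S × P × X,
      if (s = s' ∧ p = p') ∧ (fun j => (y j).1) = s ∧ (fun j => (y j).2.1) = p then ω y u v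
      else 0 := by
  simp only [secretPublic, classicalMarginal, Matrix.of_apply, Matrix.sum_apply,
    Finset.sum_filter, Prod.mk.injEq]
  split_ifs with h
  · simp [h]
  · simp [h]

theorem secretPublic_eq_sum_kronecker (ω : (Fin n → S × P × X) → Matrix e e ℂ) :
    secretPublic ω = ∑ y : Fin n → S × P × X,
      Matrix.diagonal (Pi.single (fun j => (y j).1) (1 : ℂ)) ⊗ₖ
        (Matrix.diagonal (Pi.single (fun j => (y j).2.1) (1 : ℂ)) ⊗ₖ ω y) := by
  ext ⟨s, p, u⟩ ⟨s', p', v⟩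
  rw [secretPublic_apply, Matrix.sum_apply]
  refine Finset.sum_congr rfl fun y _ => ?_
  simp only [Matrix.kroneckerMap_apply, Matrix.diagonal_apply, Pi.single_apply]
  split_ifs <;> simp_all

theorem secretPublic_posSemidef {ω : (Fin n → S × P × X) → Matrix e e ℂ}
    (hω : ∀ y, (ω y).PosSemidef) : (secretPublic ω).PosSemidef := by
  rw [secretPublic_eq_sum_kronecker]
  exact Matrix.posSemidef_sum _ fun y _ => (diagonal_single_posSemidef _).kronecker
    ((diagonal_single_posSemidef _).kronecker (hω y))

theorem trace_secretPublic (ω : (Fin n → S × P × X) → Matrix e e ℂ) :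
    (secretPublic ω).trace = ∑ y, (ω y).trace := by
  rw [secretPublic_eq_sum_kronecker, Matrix.trace_sum]
  refine Finset.sum_congr rfl fun y _ => ?_
  rw [Matrix.trace_kronecker, Matrix.trace_kronecker, Matrix.trace_diagonal, Matrix.trace_diagonal]
  simp

theorem trace_secretPublic_conditioned {ω : (Fin n → S × P × X) → Matrix e e ℂ}
    {Ω : Finset (Fin n → X)} (h : 0 < eventProb ω Ω) :
    (secretPublic (conditioned ω Ω)).trace.re = 1 := by
  rw [trace_secretPublic, Complex.re_sum]
  have h1 : ∀ y, (conditioned ω Ω y).trace.re =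
      if testResults y ∈ Ω then (eventProb ω Ω)⁻¹ * (ω y).trace.re else 0 := by
    intro y
    unfold conditioned
    split_ifs
    · rw [Matrix.trace_smul, ← Complex.ofReal_inv, smul_eq_mul, Complex.re_ofReal_mul]
    · simp
  simp only [h1]
  rw [← Finset.sum_filter, ← Finset.mul_sum]
  exact inv_mul_cancel₀ h.ne'

variable (e L) in
/-- The Kraus operators of the partial trace over the last register. -/
def discardKraus (b : Type*) [DecidableEq b] (k : L) : Matrix (b × e × L) (b × e) ℂ :=
  (1 : Matrix (b × e × L) (b × e × L) ℂ).submatrix id fun x => (x.1, x.2, k)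

theorem sum_discardKraus {b : Type*} [Fintype b] [DecidableEq b] :
    ∑ k, discardKraus e L b k * (discardKraus e L b k)ᴴ = 1 := by
  ext i j
  have h : ∀ F : b × e × L → ℂ, ∑ k, ∑ x : b × e, F (x.1, x.2, k) = ∑ z, F z := by
    intro F
    simp only [Fintype.sum_prod_type]
    rw [Finset.sum_comm]
    exact Finset.sum_congr rfl fun p _ => Finset.sum_comm
  calc _ = ∑ k, ∑ x : b × e, (1 : Matrix (b × e × L) (b × e × L) ℂ) i (x.1, x.2, k) *
        (1 : Matrix (b × e × L) (b × e × L) ℂ)ᴴ (x.1, x.2, k) j := by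
        rw [Matrix.sum_apply]
        rfl
    _ = ((1 : Matrix (b × e × L) (b × e × L) ℂ) * (1 : Matrix (b × e × L) (b × e × L) ℂ)ᴴ) i j := by
        rw [h fun z => (1 : Matrix (b × e × L) (b × e × L) ℂ) i z *
          (1 : Matrix (b × e × L) (b × e × L) ℂ)ᴴ z j, Matrix.mul_apply]
    _ = _ := by rw [Matrix.conjTranspose_one, Matrix.mul_one]

theorem krausMap_one_submatrix {a b κ : Type*} [Fintype a] [Fintype b] [DecidableEq b] [Fintype κ]
    (f : κ → a → b) (ρ : Matrix b b ℂ) :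
    krausMap (fun k => (1 : Matrix b b ℂ).submatrix id (f k)) ρ =
      ∑ k, ρ.submatrix (f k) (f k) := by
  refine Finset.sum_congr rfl fun k _ => ?_
  ext i j
  simp [Matrix.mul_apply, Matrix.one_apply, apply_ite]

/-- Presents the discarding of the labels as a channel on the conditioning system only, the form
required by the entropy inequalities. -/
theorem krausMap_discardKraus_secretPublic
    (ω : (Fin n → S × P × X) → Matrix (e × L) (e × L) ℂ) :
    krausMap (fun k => (1 : Matrix (Fin n → S) (Fin n → S) ℂ) ⊗ₖ discardKraus e L (Fin n → P) k)
      (secretPublic ω) = secretPublic fun y => traceRight (ω y) := by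
  have h : ∀ k, (1 : Matrix (Fin n → S) (Fin n → S) ℂ) ⊗ₖ discardKraus e L (Fin n → P) k =
      (1 : Matrix ((Fin n → S) × (Fin n → P) × e × L) _ ℂ).submatrix id
        fun x : (Fin n → S) × (Fin n → P) × e => (x.1, x.2.1, x.2.2, k) := by
    intro k
    conv_rhs => rw [← Matrix.one_kronecker_one]
    rfl
  simp only [h]
  rw [krausMap_one_submatrix]
  ext ⟨s, p, u⟩ ⟨s', p', v⟩
  simp only [Matrix.sum_apply, Matrix.submatrix_apply, secretPublic_apply, traceRight,
    Matrix.of_apply]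
  rw [Finset.sum_comm]
  refine Finset.sum_congr rfl fun y _ => ?_
  split_ifs <;> simp

end Discard

/-! ### Sequential application of the channels -/

section Sequential

variable {n : ℕ} {S P X : Type*} {d : Fin n → Type*} {e : Type*}

theorem Remaining.cons_self (i : Fin n) (a : d i) (b : Remaining d i.succ)
    (h : ((i.castSucc : Fin (n + 1)) : ℕ) ≤ i) : Remaining.cons i a b ⟨i, h⟩ = a := by
  simp [Remaining.cons]

theorem Remaining.cons_of_lt (i : Fin n) (a : d i) (b : Remaining d i.succ) (j : Fin n)
    (h : ((i.castSucc : Fin (n + 1)) : ℕ) ≤ j) (h' : ((i.succ : Fin (n + 1)) : ℕ) ≤ j) :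
    Remaining.cons i a b ⟨j, h⟩ = b ⟨j, h'⟩ := by
  have hij : i ≠ j := by
    rintro rfl
    simp at h'
  simp [Remaining.cons, hij]

/-- The identification `Q_i ⊗ R_i = R_{i-1}` on basis vectors. -/
def Remaining.consEquiv (i : Fin n) : d i × Remaining d i.succ ≃ Remaining d i.castSucc where
  toFun x := Remaining.cons i x.1 x.2
  invFun r := (r ⟨i, le_rfl⟩, fun j => r ⟨j.1, (Nat.le_succ _).trans j.2⟩)
  left_inv x := by
    refine Prod.ext (Remaining.cons_self i _ _ _) ?_
    funext j
    exact Remaining.cons_of_lt i _ _ _ _ j.2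
  right_inv r := by
    funext ⟨j, hj⟩
    by_cases h : i = j
    · subst h
      exact Remaining.cons_self i _ _ _
    · exact Remaining.cons_of_lt i _ _ j hj
        (Nat.succ_le_of_lt (lt_of_le_of_ne hj fun h' => h (Fin.ext h')))

theorem prod_remaining_castSucc (i : Fin n)
    (f : {j : Fin n // ((i.castSucc : Fin (n + 1)) : ℕ) ≤ j} → ℂ) :
    ∏ j, f j = f ⟨i, le_rfl⟩ *
      ∏ j : {j : Fin n // ((i.succ : Fin (n + 1)) : ℕ) ≤ j},
        f ⟨j.1, (Nat.le_succ _).trans j.2⟩ := by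
  rw [← Finset.mul_prod_erase Finset.univ f (Finset.mem_univ ⟨i, le_rfl⟩)]
  congr 1
  symm
  refine Finset.prod_bij (fun j _ => ⟨j.1, (Nat.le_succ _).trans j.2⟩) ?_ ?_ ?_ ?_
  · intro j _
    rw [Finset.mem_erase]
    refine ⟨fun h => ?_, Finset.mem_univ _⟩
    have h1 : j.1 = i := congrArg Subtype.val h
    have h2 := j.2
    rw [h1] at h2
    simp at h2
  · intro j _ j' _ h
    exact Subtype.ext (Subtype.mk.inj h)
  · intro j hj
    have hne : i ≠ j.1 := fun h => (Finset.mem_erase.1 hj).1 (Subtype.ext h.symm)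
    exact ⟨⟨j.1, Nat.succ_le_of_lt (lt_of_le_of_ne j.2 fun h' => hne (Fin.ext h'))⟩,
      Finset.mem_univ _, rfl⟩
  · intro j _
    rfl

theorem toInitial_isState [∀ i, Fintype (d i)] [Fintype e]
    {ρ : Matrix ((∀ i, d i) × e) ((∀ i, d i) × e) ℂ} (hρ : IsState ρ) :
    IsState (toInitial ρ) := by
  refine ⟨hρ.1.submatrix _, ?_⟩
  rw [← hρ.2]
  let φ : Remaining d 0 × e ≃ (∀ i, d i) × e :=
    ⟨fun u => (fun j => u.1 ⟨j, Nat.zero_le _⟩, u.2), fun u => (fun j => u.1 j.1, u.2),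
      fun _ => rfl, fun _ => rfl⟩
  exact φ.sum_comp fun x => ρ x x

variable [∀ i, Fintype (d i)] [DecidableEq X] (M : ∀ i, S → P → Matrix (d i) (d i) ℂ)
  (t : Fin n → S → P → X)

theorem roundChannel_apply (i : Fin n) (y : S × P × X)
    (ω : Matrix (Remaining d i.castSucc) (Remaining d i.castSucc) ℂ) :
    roundChannel M t i y.1 y.2.1 y.2.2 ω = contract (outcomePOVM M t i y)
      (ω.submatrix (Remaining.consEquiv i) (Remaining.consEquiv i)) := by
  ext b b'
  simp only [roundChannel, LinearMap.coe_mk, AddHom.coe_mk, Matrix.of_apply, contract_apply,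
    outcomePOVM]
  split_ifs
  · rfl
  · simp

theorem tensorId_roundChannel (i : Fin n) (y : S × P × X)
    (ω : Matrix (Remaining d i.castSucc × e) (Remaining d i.castSucc × e) ℂ) :
    tensorId (roundChannel M t i y.1 y.2.1 y.2.2) ω = contract (outcomePOVM M t i y)
      (ω.submatrix (fun x : d i × Remaining d i.succ × e => (Remaining.cons i x.1 x.2.1, x.2.2))
        (fun x : d i × Remaining d i.succ × e => (Remaining.cons i x.1 x.2.1, x.2.2))) := by
  ext ⟨b, u⟩ ⟨b', v⟩
  simp only [tensorId, Matrix.of_apply, roundChannel_apply]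
  rfl

/-- Round `i` contracts its own factor; contracting the remaining factors afterwards amounts to one
contraction with the product effect. -/
theorem contract_tensorId_roundChannel (i : Fin n) (y : Fin n → S × P × X)
    (ω : Matrix (Remaining d i.castSucc × e) (Remaining d i.castSucc × e) ℂ) :
    contract (piMat fun j : {j : Fin n // ((i.succ : Fin (n + 1)) : ℕ) ≤ j} =>
        outcomePOVM M t j.1 (y j.1)) (tensorId (roundChannel M t i (y i).1 (y i).2.1 (y i).2.2) ω) =
      contract (piMat fun j : {j : Fin n // ((i.castSucc : Fin (n + 1)) : ℕ) ≤ j} =>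
        outcomePOVM M t j.1 (y j.1)) ω := by
  rw [tensorId_roundChannel]
  ext u v
  simp only [contract_apply]
  rw [← (Remaining.consEquiv i).sum_comp]
  simp only [← (Remaining.consEquiv (d := d) i).sum_comp (fun r => _ * ω (_, u) (r, v)),
    Fintype.sum_prod_type]
  have hp : ∀ a a' b b',
      piMat (fun j : {j : Fin n // ((i.castSucc : Fin (n + 1)) : ℕ) ≤ j} =>
        outcomePOVM M t j.1 (y j.1))
          (Remaining.consEquiv i (a', b')) (Remaining.consEquiv i (a, b)) =
      outcomePOVM M t i (y i) a' a *
        piMat (fun j : {j : Fin n // ((i.succ : Fin (n + 1)) : ℕ) ≤ j} =>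
          outcomePOVM M t j.1 (y j.1)) b' b := by
    intro a a' b b'
    rw [piMat_apply, prod_remaining_castSucc]
    congr 1
    · simp only [Remaining.consEquiv, Equiv.coe_fn_mk, Remaining.cons_self]
    · refine Finset.prod_congr rfl fun j _ => ?_
      simp only [Remaining.consEquiv, Equiv.coe_fn_mk, Remaining.cons_of_lt i _ _ j.1 _ j.2]
  simp only [hp, Finset.mul_sum]
  conv_rhs => rw [Finset.sum_comm]
  refine Finset.sum_congr rfl fun b _ => ?_
  rw [Finset.sum_comm]
  refine Finset.sum_congr rfl fun a _ => ?_
  rw [Finset.sum_comm]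
  refine Finset.sum_congr rfl fun a' _ => Finset.sum_congr rfl fun b' _ => ?_
  rw [mul_assoc]
  exact mul_left_comm _ _ _

/-- An invariant in `k`: run `k` rounds sequentially and the rest in parallel. It is the parallel
output at `k = 0` and, up to the trivial last register, the sequential output at `k = n`. -/
theorem contract_eatState (ρ : Matrix ((∀ i, d i) × e) ((∀ i, d i) × e) ℂ)
    (y : Fin n → S × P × X) (k : Fin (n + 1)) :
    contract (piMat fun j : {j : Fin n // (k : ℕ) ≤ j} => outcomePOVM M t j.1 (y j.1))
        (eatState (roundChannel M t) (toInitial ρ) k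
          fun j => y (j.castLE (Nat.le_of_lt_succ k.isLt))) =
      outputState M t ρ y := by
  induction k using Fin.induction with
  | zero =>
    rw [outputState_eq_contract]
    let φ : Remaining d 0 ≃ (∀ i, d i) :=
      ⟨fun u j => u ⟨j, Nat.zero_le _⟩, fun u j => u j.1, fun _ => rfl, fun _ => rfl⟩
    let ψ : {j : Fin n // ((0 : Fin (n + 1)) : ℕ) ≤ j} ≃ Fin n :=
      ⟨fun j => j.1, fun j => ⟨j, Nat.zero_le _⟩, fun _ => rfl, fun _ => rfl⟩
    ext u v
    simp only [contract_apply]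
    rw [← φ.sum_comp]
    refine Finset.sum_congr rfl fun a _ => ?_
    rw [← φ.sum_comp]
    refine Finset.sum_congr rfl fun a' _ => ?_
    congr 1
    rw [piMat_apply, piMat_apply, ← ψ.prod_comp]
    rfl
  | succ i ih =>
    rw [← ih, ← contract_tensorId_roundChannel]
    rfl

/-- Sequential application of the channels yields the output state of the parallel measurement. -/
theorem eatOutput_roundChannel [∀ i, DecidableEq (d i)]
    (ρ : Matrix ((∀ i, d i) × e) ((∀ i, d i) × e) ℂ) :
    eatOutput (roundChannel M t) (toInitial ρ) = outputState M t ρ := by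
  funext y
  rw [← contract_eatState M t ρ y (Fin.last n)]
  -- No system remains after the last round, so the remaining effect is an empty product, the
  -- identity on a one-dimensional space.
  have : IsEmpty {j : Fin n // ((Fin.last n : Fin (n + 1)) : ℕ) ≤ j} :=
    ⟨fun j => absurd j.1.isLt (not_lt.2 j.2)⟩
  have h1 : (piMat fun j : {j : Fin n // ((Fin.last n : Fin (n + 1)) : ℕ) ≤ j} =>
      outcomePOVM M t j.1 (y j.1)) = 1 := by
    ext a b
    rw [Subsingleton.elim a b, Matrix.one_apply_eq, piMat_apply, Finset.univ_eq_empty,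
      Finset.prod_empty]
  rw [h1, contract_one]
  rfl

variable {M} [Fintype S] [Fintype P] [Fintype X]

theorem isEATChannel_roundChannel [∀ i, DecidableEq (d i)] (hM : ∀ i, IsPOVM (M i)) (i : Fin n) :
    IsEATChannel (roundChannel M t i) := by
  classical
  refine ⟨fun s p x k ω hω => ?_, fun ω => ?_, t i, fun s p x hx => ?_⟩
  · rw [tensorId_roundChannel M t i (s, p, x)]
    exact contract_posSemidef (outcomePOVM_posSemidef t hM i _) (hω.submatrix _)
  · have h : ∀ s p x, (roundChannel M t i s p x ω) = contract (outcomePOVM M t i (s, p, x))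
      (ω.submatrix (Remaining.consEquiv i) (Remaining.consEquiv i)) :=
      fun s p x => roundChannel_apply M t i (s, p, x) ω
    simp only [h]
    have h2 : ∑ s, ∑ p, ∑ x, (contract (outcomePOVM M t i (s, p, x))
        (ω.submatrix (Remaining.consEquiv i) (Remaining.consEquiv i))).trace =
        ∑ y : S × P × X, (contract (outcomePOVM M t i y)
        (ω.submatrix (Remaining.consEquiv i) (Remaining.consEquiv i))).trace := by
      simp only [Fintype.sum_prod_type]
    rw [h2, ← Matrix.trace_sum, ← contract_sum, sum_outcomePOVM t hM, contract_one,
      trace_traceLeft]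
    exact (Remaining.consEquiv i).sum_comp fun r => ω r r
  · ext ω b b'
    simp [roundChannel, hx]

end Sequential

end QKD

end

/-! ### The main theorem -/

theorem mainTheorem2 {n : ℕ} {S P X : Type*} [Fintype S] [DecidableEq S] [Fintype P] [DecidableEq P]
    [Fintype X] [DecidableEq X]
    {d : Fin n → Type*} [∀ i, Fintype (d i)] [∀ i, DecidableEq (d i)]
    (M : ∀ i, S → P → Matrix (d i) (d i) ℂ) (hM : ∀ i, QKD.IsPOVM (M i))
    (t : Fin n → S → P → X) :
    (∀ i, QKD.WeaklyDependent (M i) ↔ QKD.AnnouncementsCommute (M i)) ∧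
    ((∀ i, QKD.WeaklyDependent (M i) ∨ QKD.AnnouncementsCommute (M i)) →
      (∃ V : ∀ i, QKD.BlockDecomposition (d i), ∀ i, QKD.WeaklyDependentAlong (M i) (V i)) ∧
      ∀ V : ∀ i, QKD.BlockDecomposition (d i), (∀ i, QKD.WeaklyDependentAlong (M i) (V i)) →
      ∀ (e : Type*) [Fintype e] [DecidableEq e]
        (ρ : Matrix ((∀ i, d i) × e) ((∀ i, d i) × e) ℂ), QKD.IsState ρ →
      QKD.eatOutput (QKD.roundChannel M t) (QKD.toInitial ρ) = QKD.outputState M t ρ ∧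
      ∃ ν : Matrix ((∀ i, d i) × e × QKD.Labels V) ((∀ i, d i) × e × QKD.Labels V) ℂ,
        QKD.IsState ν ∧
        QKD.IsBlockDiagonalAttack V ν ∧
        (∀ y, QKD.traceRight (QKD.outputState M t ν y) = QKD.outputState M t ρ y) ∧
        QKD.eatOutput (QKD.roundChannel M t) (QKD.toInitial ν) = QKD.outputState M t ν ∧
        QKD.MarkovConditions (QKD.outputState M t ν) ∧
        QKD.EATHypotheses (QKD.roundChannel M t) (QKD.toInitial ν) ∧
        ∀ Ω : Finset (Fin n → X),
          QKD.eventProb (QKD.outputState M t ν) Ω = QKD.eventProb (QKD.outputState M t ρ) Ω ∧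
          (0 < QKD.eventProb (QKD.outputState M t ρ) Ω →
            (∀ α : ℝ, 1 < α → α < 2 →
              QKD.renyiEntropyUp α
                  (QKD.secretPublic (QKD.conditioned (QKD.outputState M t ν) Ω)) ≤
                QKD.renyiEntropyUp α
                  (QKD.secretPublic (QKD.conditioned (QKD.outputState M t ρ) Ω))) ∧
            ∀ ε : ℝ, 0 ≤ ε → ε < 1 →
              QKD.smoothMinEntropy ε
                  (QKD.secretPublic (QKD.conditioned (QKD.outputState M t ν) Ω)) ≤
                QKD.smoothMinEntropy ε
                  (QKD.secretPublic (QKD.conditioned (QKD.outputState M t ρ) Ω)))) := by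
  refine ⟨fun i => QKD.weaklyDependent_iff_announcementsCommute (hM i), fun h => ⟨?_, ?_⟩⟩
  · have hA : ∀ i, QKD.WeaklyDependent (M i) := fun i =>
      (h i).elim id (QKD.weaklyDependent_iff_announcementsCommute (hM i)).2
    choose V hV using hA
    exact ⟨V, hV⟩
  intro V hV e _ _ ρ hρ
  have hν := QKD.blockAttack_isState V hρ
  have hseq := QKD.eatOutput_roundChannel M t (QKD.blockAttack V ρ)
  have hmarkov := QKD.markovConditions_outputState_blockAttack t hM hV hρ.1
  have htr := QKD.traceRight_outputState_blockAttack t hV ρ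
  have hρfun : QKD.outputState M t ρ =
      fun y => QKD.traceRight (QKD.outputState M t (QKD.blockAttack V ρ) y) :=
    funext fun y => (htr y).symm
  refine ⟨QKD.eatOutput_roundChannel M t ρ, QKD.blockAttack V ρ, hν,
    QKD.blockAttack_isBlockDiagonalAttack V hρ.1, htr, hseq, hmarkov,
    ⟨QKD.isEATChannel_roundChannel t hM, ?_, QKD.toInitial_isState hν, hseq ▸ hmarkov⟩,
    fun Ω => ?_⟩
  · have : IsEmpty {j : Fin n // ((Fin.last n : Fin (n + 1)) : ℕ) ≤ j} :=
      ⟨fun j => absurd j.1.isLt (not_lt.2 j.2)⟩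
    exact ⟨Pi.uniqueOfIsEmpty _⟩
  · have hprob : QKD.eventProb (QKD.outputState M t (QKD.blockAttack V ρ)) Ω =
        QKD.eventProb (QKD.outputState M t ρ) Ω := by
      rw [hρfun, QKD.eventProb_traceRight]
    have hpsd := QKD.secretPublic_posSemidef (QKD.conditioned_posSemidef
      (QKD.outputState_posSemidef t hM hν.1) Ω)
    -- After conditioning on `Ω`, the state for `ρ` is the image of the state for the block attack
    -- under discarding the labels.
    have hdiscard := QKD.krausMap_discardKraus_secretPublic
      (QKD.conditioned (QKD.outputState M t (QKD.blockAttack V ρ)) Ω)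
    rw [← QKD.conditioned_traceRight, ← hρfun] at hdiscard
    refine ⟨hprob, fun hpos => ⟨fun α hα _ => ?_, fun ε _ _ => ?_⟩⟩
    · rw [← hdiscard]
      refine QKD.renyiEntropyUp_le_krausMap QKD.sum_discardKraus hpsd ?_ hα
      rw [QKD.trace_secretPublic_conditioned (hprob ▸ hpos)]
      exact one_pos
    · rw [← hdiscard]
      exact QKD.smoothMinEntropy_le_krausMap QKD.sum_discardKraus hpsd ε
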